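/- For integers $s_1,\dots,s_l>0$ let $$[s_1,\dots,s_l]=\frac{1}{(s_1-1)!\cdots(s_l-1)!}\sum_{n>0}\ \Big(\sum_{\substack{u_1v_1+\dots+u_lv_l=n\\ u_1>\dots>u_l>0,\ v_1,\dots,v_l>0}} v_1^{s_1-1}\cdots v_l^{s_l-1}\Big)q^n\ \in\mathbb{Q}[[q]],$$ and let the empty bracket be $[\emptyset]=1$. Let $\mathcal{MD}\subset\mathbb{Q}[[q]]$ be the $\mathbb{Q}$-vector space spanned by all brackets (including $1$), let $\mathrm{Fil}^W_k(\mathcal{MD})$ be the span of the brackets with $s_1+\dots+s_l\le k$ (including $1$), and let $\mathrm{d}=q\frac{d}{dq}$. Let $\mathcal{MDA}$, $\mathcal{MD}^\sharp$, $\mathcal{MD}^{even}$ be the spans of $1$ and of the brackets with, respectively, $s_1>1$; all $s_j>1$; all $s_j$ even. For $k\ge 0$ let $M_k$ be the space of those $F=\sum_{n\ge0}a_nq^n\in\mathbb{Q}[[q]]$ which are the Fourier expansion ($q=e^{2\pi i\tau}$) of a modular form of weight $k$ for $\mathrm{SL}_2(\mathbb{Z})$, and let $\widetilde M_k$ be the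 space of those which are the Fourier expansion of a quasi-modular form of weight $k$ for $\mathrm{SL}_2(\mathbb{Z})$, i.e. of a function $f$ on the upper half plane for which there are $p\ge0$ and holomorphic functions $f_0,\dots,f_p$ on the upper half plane, bounded as $\operatorname{Im} z\to\infty$, with $(cz+d)^{-k}f\big(\tfrac{az+b}{cz+d}\big)=\sum_{j=0}^{p}f_j(z)\big(\tfrac{c}{cz+d}\big)^j$ for all $\begin{pmatrix}a&b\\c&d\end{pmatrix}\in \mathrm{SL}_2(\mathbb{Z})$ and all $z$. Let $M=\sum_k M_k$ and $\widetilde M=\sum_k\widetilde M_k$. For even $k\geq 2$ put $G_k=-\frac{B_k}{2\,k!}+[k]$, where $B_k$ is the $k$-th Bernoulli number. Then: (0) $\mathcal{MD}$ is a subalgebra of $\mathbb{Q}[[q]]$, filtered by weight, and it is closed under the derivation $\mathrm{d}$: $\mathrm{Fil}^W_k\cdot\mathrm{Fil}^W_l\subset\mathrm{Fil}^W_{k+l}$, $\mathrm{d}\,\mathcal{MD}\subset\mathcal{MD}$ and $\mathrm{d}\,\mathrm{Fil}^W_k\subset\mathrm{Fil}^W_{k+2}$ for all $k,l\ge0$.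 (i) $M=\bigoplus_{k}M_k$ and $\widetilde M=\bigoplus_k\widetilde M_k$ (the sums are direct in $\mathbb{Q}[[q]]$), and both are graded $\mathbb{Q}$-algebras and subalgebras of $\mathcal{MD}$, with $M_k\subset\mathrm{Fil}^W_k(\mathcal{MD})$ and $\widetilde M_k\subset\mathrm{Fil}^W_k(\mathcal{MD})$ for all $k$. (ii) $\widetilde M$ is closed under $\mathrm{d}$, with $\mathrm{d}\widetilde M_k\subset\widetilde M_{k+2}$ for all $k$; so it is a differential subalgebra of $(\mathcal{MD},\mathrm{d})$. Moreover $$\mathrm{d}G_2=5G_4-2G_2^2,\qquad \mathrm{d}G_4=14G_6-8G_2G_4,\qquad \mathrm{d}G_6=\tfrac{120}{7}G_4^2-12G_2G_6 .$$ (iii) $\mathcal{MD}^{even}$, $\mathcal{MD}^\sharp$ and $\mathcal{MDA}$ are subalgebras of $\mathcal{MD}$, $M_k\subset\widetilde M_k$ for all $k$, and there are inclusions of $\mathbb{Q}$-algebras $$M\subset\widetilde M\subset\mathcal{MD}^{even}\subset\mathcal{MD}^\sharp\subset\mathcal{MDA}\subset\mathcal{MD},$$ where $\subset$ allows equality. 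-/

import Mathlib

open scoped PowerSeries MatrixGroups ModularForm Manifold

namespace BracketAlgebra

/-- The multiple divisor sum `σ_{r₁,…,r_l}(n)`: the sum of `v₁^{r₁} ⋯ v_l^{r_l}` over all positive
integers `u₁ > ⋯ > u_l > 0` and `v₁, …, v_l > 0` with `u₁ v₁ + ⋯ + u_l v_l = n`.
(All `u_i`, `v_i` occurring here lie in `{1, …, n}`.) -/
def multipleDivisorSum {l : ℕ} (r : Fin l → ℕ) (n : ℕ) : ℕ :=
  ∑ p ∈ ((Fintype.piFinset fun _ : Fin l => Finset.Icc 1 n) ×ˢ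
      (Fintype.piFinset fun _ : Fin l => Finset.Icc 1 n)) with
      (∀ i j : Fin l, i < j → p.1 j < p.1 i) ∧ ∑ i, p.1 i * p.2 i = n,
    ∏ i, p.2 i ^ r i

/-- The bracket `[s₁, …, s_l]` (used only for `s₁, …, s_l > 0`); for `l = 0` it is `1`, see
`bracket_nil`. -/
noncomputable def bracket {l : ℕ} (s : Fin l → ℕ) : ℚ⟦X⟧ :=
  PowerSeries.mk fun n =>
    (multipleDivisorSum (fun i => s i - 1) n : ℚ) / ∏ i, ((s i - 1).factorial : ℚ)

/-- The empty bracket is `1`. -/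
theorem bracket_nil (s : Fin 0 → ℕ) : bracket s = 1 := by
  ext n
  rcases Nat.eq_zero_or_pos n with rfl | hn
  · simp [bracket, multipleDivisorSum]
  · simp [bracket, multipleDivisorSum, PowerSeries.coeff_one, hn.ne, hn.ne']

/-- The space `MD` spanned over `ℚ` by `1` and all brackets. -/
noncomputable def MD : Submodule ℚ ℚ⟦X⟧ :=
  Submodule.span ℚ {F | ∃ (l : ℕ) (s : Fin l → ℕ), (∀ i, 0 < s i) ∧ F = bracket s}

/-- The weight filtration `Fil^W_k(MD)`, spanned by the brackets of weight at most `k`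
(including `1`, the empty bracket of weight `0`). -/
noncomputable def weightFil (k : ℕ) : Submodule ℚ ℚ⟦X⟧ :=
  Submodule.span ℚ {F | ∃ (l : ℕ) (s : Fin l → ℕ),
    (∀ i, 0 < s i) ∧ ∑ i, s i ≤ k ∧ F = bracket s}

/-- The space `MDA` of admissible brackets, spanned by `1` and all `[s₁, …, s_l]` with `s₁ > 1`. -/
noncomputable def MDA : Submodule ℚ ℚ⟦X⟧ :=
  Submodule.span ℚ {F | ∃ (l : ℕ) (s : Fin l → ℕ),
    (∀ i, 0 < s i) ∧ (∀ i, i.val = 0 → 1 < s i) ∧ F = bracket s}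

/-- The space `MD^♯` spanned by `1` and all `[s₁, …, s_l]` with all `s_j > 1`. -/
noncomputable def MDSharp : Submodule ℚ ℚ⟦X⟧ :=
  Submodule.span ℚ {F | ∃ (l : ℕ) (s : Fin l → ℕ), (∀ i, 1 < s i) ∧ F = bracket s}

/-- The space `MD^{even}` spanned by `1` and all `[s₁, …, s_l]` with all `s_j` even. -/
noncomputable def MDEven : Submodule ℚ ℚ⟦X⟧ :=
  Submodule.span ℚ {F | ∃ (l : ℕ) (s : Fin l → ℕ),
    (∀ i, 0 < s i ∧ Even (s i)) ∧ F = bracket s}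

/-- The derivation `d = q d/dq` of `ℚ⟦q⟧`. -/
noncomputable def d : Derivation ℚ ℚ⟦X⟧ ℚ⟦X⟧ :=
  (PowerSeries.X : ℚ⟦X⟧) • PowerSeries.derivative ℚ

/-- `F ∈ ℚ⟦q⟧` is the Fourier expansion of the function `f` on the upper half plane, i.e.
`f(τ) = ∑ aₙ qⁿ` with `q = exp(2πiτ)` for all `τ`. -/
def IsFourierExpansion (F : ℚ⟦X⟧) (f : UpperHalfPlane → ℂ) : Prop :=
  ∀ τ : UpperHalfPlane,
    HasSum (fun n : ℕ => ((PowerSeries.coeff n F : ℚ) : ℂ) *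
      Complex.exp (2 * Real.pi * Complex.I * (τ : ℂ)) ^ n) (f τ)

/-- A quasi-modular form of weight `k` for `SL₂(ℤ)`: there are an integer `p ≥ 0` and holomorphic
functions `f₀, …, f_p` on the upper half plane, bounded at `i∞`, such that
`(cz+d)^{-k} f((az+b)/(cz+d)) = ∑_{j ≤ p} f_j(z) (c/(cz+d))^j` for all `(a b; c d) ∈ SL₂(ℤ)`.
(The identity matrix gives `f = f₀`.) -/
def IsQuasiModularForm (k : ℕ) (f : UpperHalfPlane → ℂ) : Prop :=
  ∃ (p : ℕ) (g : ℕ → UpperHalfPlane → ℂ),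
    (∀ j ≤ p, MDifferentiable 𝓘(ℂ) 𝓘(ℂ) (g j) ∧ UpperHalfPlane.IsBoundedAtImInfty (g j)) ∧
    ∀ (γ : SL(2, ℤ)) (z : UpperHalfPlane),
      (f ∣[(k : ℤ)] γ) z =
        ∑ j ∈ Finset.range (p + 1), g j z * ((γ 1 0 : ℂ) / UpperHalfPlane.denom γ z) ^ j

/-- The functions in the definition of a quasi-modular form may be taken to vanish for `j > p`,
and `p` may be enlarged. -/
theorem IsQuasiModularForm.exists_ge {k : ℕ} {f : UpperHalfPlane → ℂ}
    (h : IsQuasiModularForm k f) : ∃ p : ℕ, ∀ n ≥ p, ∃ g : ℕ → UpperHalfPlane → ℂ,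
    (∀ j, MDifferentiable 𝓘(ℂ) 𝓘(ℂ) (g j) ∧ UpperHalfPlane.IsBoundedAtImInfty (g j)) ∧
    ∀ (γ : SL(2, ℤ)) (z : UpperHalfPlane),
      (f ∣[(k : ℤ)] γ) z =
        ∑ j ∈ Finset.range (n + 1), g j z * ((γ 1 0 : ℂ) / UpperHalfPlane.denom γ z) ^ j := by
  obtain ⟨p, g, hg, hf⟩ := h
  refine ⟨p, fun n hn => ⟨fun j => if j ≤ p then g j else 0, fun j => ?_, fun γ z => ?_⟩⟩
  · by_cases hj : j ≤ p
    · simpa [hj] using hg j hj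
    · simp only [hj, if_false]
      exact ⟨mdifferentiable_const, Filter.const_boundedAtFilter _ 0⟩
  · rw [hf γ z]
    refine (Finset.sum_subset_zero_on_sdiff (fun j hj => ?_) (fun j hj => ?_)
      (fun j hj => ?_))
    · simp only [Finset.mem_range] at hj ⊢
      omega
    · have : ¬ j ≤ p := by
        simp only [Finset.mem_sdiff, Finset.mem_range] at hj
        omega
      simp [this]
    · have : j ≤ p := by
        simp only [Finset.mem_range] at hj
        omega
      simp [this]

theorem IsQuasiModularForm.add {k : ℕ} {f₁ f₂ : UpperHalfPlane → ℂ}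
    (h₁ : IsQuasiModularForm k f₁) (h₂ : IsQuasiModularForm k f₂) :
    IsQuasiModularForm k (f₁ + f₂) := by
  obtain ⟨p₁, h₁⟩ := h₁.exists_ge
  obtain ⟨p₂, h₂⟩ := h₂.exists_ge
  obtain ⟨g₁, hg₁, hf₁⟩ := h₁ (max p₁ p₂) (le_max_left _ _)
  obtain ⟨g₂, hg₂, hf₂⟩ := h₂ (max p₁ p₂) (le_max_right _ _)
  refine ⟨max p₁ p₂, g₁ + g₂, fun j _ => ⟨(hg₁ j).1.add (hg₂ j).1, (hg₁ j).2.add (hg₂ j).2⟩,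
    fun γ z => ?_⟩
  rw [SlashAction.add_slash, Pi.add_apply, hf₁, hf₂, ← Finset.sum_add_distrib]
  refine Finset.sum_congr rfl fun j _ => ?_
  simp only [Pi.add_apply]
  ring

theorem IsQuasiModularForm.smul {k : ℕ} {f : UpperHalfPlane → ℂ} (c : ℂ)
    (h : IsQuasiModularForm k f) : IsQuasiModularForm k (c • f) := by
  obtain ⟨p, g, hg, hf⟩ := h
  refine ⟨p, fun j => c • g j, fun j hj => ⟨(hg j hj).1.const_smul c, (hg j hj).2.smul c⟩,
    fun γ z => ?_⟩
  rw [ModularForm.SL_smul_slash, Pi.smul_apply, hf, Finset.smul_sum]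
  refine Finset.sum_congr rfl fun j _ => ?_
  simp only [Pi.smul_apply, smul_eq_mul]
  ring

theorem isQuasiModularForm_zero (k : ℕ) : IsQuasiModularForm k 0 :=
  ⟨0, 0, fun _ _ => ⟨mdifferentiable_const, Filter.const_boundedAtFilter _ 0⟩, fun γ z => by simp⟩

theorem isFourierExpansion_zero : IsFourierExpansion 0 0 := fun τ => by
  simp [hasSum_zero]

theorem IsFourierExpansion.add {F₁ F₂ : ℚ⟦X⟧} {f₁ f₂ : UpperHalfPlane → ℂ}
    (h₁ : IsFourierExpansion F₁ f₁) (h₂ : IsFourierExpansion F₂ f₂) :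
    IsFourierExpansion (F₁ + F₂) (f₁ + f₂) := fun τ => by
  simpa [add_mul] using (h₁ τ).add (h₂ τ)

theorem IsFourierExpansion.smul {F : ℚ⟦X⟧} {f : UpperHalfPlane → ℂ} (c : ℚ)
    (h : IsFourierExpansion F f) : IsFourierExpansion (c • F) ((c : ℂ) • f) := fun τ => by
  simpa [mul_assoc] using (h τ).mul_left (c : ℂ)

/-- The space `M_k` of modular forms of weight `k` for `SL₂(ℤ)` with rational Fourier
coefficients, identified with their Fourier expansions in `ℚ⟦q⟧`. -/
def modularForms (k : ℕ) : Submodule ℚ ℚ⟦X⟧ where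
  carrier := {F | ∃ f : ModularForm 𝒮ℒ (k : ℤ), IsFourierExpansion F f}
  zero_mem' := ⟨0, isFourierExpansion_zero⟩
  add_mem' := by
    rintro F₁ F₂ ⟨f₁, h₁⟩ ⟨f₂, h₂⟩
    exact ⟨f₁ + f₂, h₁.add h₂⟩
  smul_mem' := by
    rintro c F ⟨f, h⟩
    exact ⟨(c : ℂ) • f, h.smul c⟩

/-- The space of quasi-modular forms of weight `k` for `SL₂(ℤ)` with rational Fourier
coefficients, identified with their Fourier expansions in `ℚ⟦q⟧`. -/
def quasiModularForms (k : ℕ) : Submodule ℚ ℚ⟦X⟧ where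
  carrier := {F | ∃ f : UpperHalfPlane → ℂ, IsQuasiModularForm k f ∧ IsFourierExpansion F f}
  zero_mem' := ⟨0, isQuasiModularForm_zero k, isFourierExpansion_zero⟩
  add_mem' := by
    rintro F₁ F₂ ⟨f₁, q₁, h₁⟩ ⟨f₂, q₂, h₂⟩
    exact ⟨f₁ + f₂, q₁.add q₂, h₁.add h₂⟩
  smul_mem' := by
    rintro c F ⟨f, q, h⟩
    exact ⟨(c : ℂ) • f, q.smul c, h.smul c⟩

/-- The ring of modular forms, the sum of all `M_k`. -/
def modularFormRing : Submodule ℚ ℚ⟦X⟧ := ⨆ k, modularForms k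

/-- The ring of quasi-modular forms, the sum of the spaces of all weights. -/
def quasiModularFormRing : Submodule ℚ ℚ⟦X⟧ := ⨆ k, quasiModularForms k

/-- The Fourier expansion `G_k = -B_k/(2 k!) + [k]` of the Eisenstein series of even weight `k`. -/
noncomputable def eisensteinG (k : ℕ) : ℚ⟦X⟧ :=
  PowerSeries.C (-(bernoulli k) / (2 * (k.factorial : ℚ))) + bracket ![k]

/-- The subspace `V` is (the underlying space of) a unital `ℚ`-subalgebra of `ℚ⟦q⟧`. -/
def IsSubalgebra (V : Submodule ℚ ℚ⟦X⟧) : Prop :=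
  1 ∈ V ∧ ∀ F ∈ V, ∀ G ∈ V, F * G ∈ V

/-- The subspace `V` is a subalgebra of `ℚ⟦q⟧` that is graded by the subspaces `W k`, `k ≥ 0`:
it is their direct sum, and `1 ∈ W 0` and `W k * W l ⊆ W (k + l)`. -/
def IsGradedSubalgebra (V : Submodule ℚ ℚ⟦X⟧) (W : ℕ → Submodule ℚ ℚ⟦X⟧) : Prop :=
  IsSubalgebra V ∧ V = ⨆ k, W k ∧ iSupIndep W ∧ SetLike.GradedMonoid W

end BracketAlgebra

namespace BracketAlgebra

/-! Writing `x = q^u`, a bracket is the limit of nested sums over `N > a₁ > ⋯ > a_l` of letters `L_s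
= ∑_v v^{s-1}/(s-1)! x^v` with `u = a + 1`. Summation by parts gives a quasi-shuffle product of
nested sums, so products of brackets are governed by the products `L_a L_b` (`wordSeq_mul_mem`).

Put `w = L_1 + 1/2` and `D = x d/dx`. Then `D w = L_2 = w² - 1/4` and `D L_s = s L_{s+1}`, so
`L_{i+2}` is `L_2` times a polynomial in `w` of degree at most `i` with the parity of `i`, and
conversely each `L_2 w^i` is a combination of letters. Hence `L_a L_b` with `a, b ≥ 2` involves only
letters of index between `2` and `a + b` and of the parity of `a + b`
(`bracketLetter_mul_mem_parityLetters`); multiplication by `L_1` keeps the indices above 1, except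
for `L_1² = L_2 - L_1`. This yields all the subalgebras and the weight filtration.

For `d`, the pairs `(u, v)` are partitions given by parts and multiplicities. Conjugation turns
polynomial weights in `v` into polynomial weights in `u` of no larger degree, and conversely. On the
sums weighted by powers of `u`, the terms of `d` in which a letter is squared are exactly those
produced by multiplication by `∑ u q^{uv}`, so the difference is again a combination of such sums
(`d_dualSeq_sub_mem`).

On the modular side, forms of level one are polynomials in `E₄` and `E₆`, by division by the
discriminant. The top coefficient of a quasi-modular transformation law is a modular form
(`slash_top_coefficient`); subtracting its product with a power of `E₂` lowers the depth, so
quasi-modular forms are polynomials in `E₂, E₄, E₆`, and a `ℚ`-linear retraction `ℂ → ℚ` makes the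
coefficients rational (`quasiModularForms_eq_span`). The Eisenstein series are even brackets plus
constants, which places everything in `MDEven`. Ramanujan's identities compare level one forms of
weight below 12, where the constant term decides; with the Leibniz rule they give closure under `d`.
Different weights are independent because the relation at `γ z`, multiplied by a power of the
cocycle `c/(cz+d)`, is a polynomial identity in the cocycle and in `c`. -/

/-! ### Brackets as limits of nested sums -/

/-- The pairs `(u, v)` over which the multiple divisor sum of `n` runs. -/
def divisorPairs (l n : ℕ) : Finset ((Fin l → ℕ) × (Fin l → ℕ)) :=
  ((Fintype.piFinset fun _ : Fin l => Finset.Icc 1 n) ×ˢ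
      (Fintype.piFinset fun _ : Fin l => Finset.Icc 1 n)).filter fun p =>
    (∀ i j : Fin l, i < j → p.1 j < p.1 i) ∧ ∑ i, p.1 i * p.2 i = n

theorem mem_divisorPairs {l n : ℕ} {p : (Fin l → ℕ) × (Fin l → ℕ)} :
    p ∈ divisorPairs l n ↔ (∀ i, 0 < p.1 i) ∧ (∀ i, 0 < p.2 i) ∧
      (∀ i j : Fin l, i < j → p.1 j < p.1 i) ∧ ∑ i, p.1 i * p.2 i = n := by
  simp only [divisorPairs, Finset.mem_filter, Finset.mem_product, Fintype.mem_piFinset,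
    Finset.mem_Icc]
  constructor
  · rintro ⟨⟨h1, h2⟩, h3, h4⟩
    exact ⟨fun i => (h1 i).1, fun i => (h2 i).1, h3, h4⟩
  · rintro ⟨h1, h2, h3, h4⟩
    have key : ∀ i, p.1 i * p.2 i ≤ n := fun i =>
      h4 ▸ Finset.single_le_sum (f := fun i => p.1 i * p.2 i) (fun _ _ => Nat.zero_le _)
        (Finset.mem_univ i)
    exact ⟨⟨fun i => ⟨h1 i, (Nat.le_mul_of_pos_right _ (h2 i)).trans (key i)⟩,
      fun i => ⟨h2 i, (Nat.le_mul_of_pos_left _ (h1 i)).trans (key i)⟩⟩, h3, h4⟩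

/-- The sequence of the series `∑_{v > 0} φ(u, v) q^{uv}`, where `u = a + 1`. -/
noncomputable def letter (φ : ℕ → ℕ → ℚ) : ℕ → ℚ⟦X⟧ := fun a =>
  PowerSeries.mk fun n => if (a + 1) ∣ n ∧ n ≠ 0 then φ (a + 1) (n / (a + 1)) else 0

/-- A tuple of exponents contributes only if each is a positive multiple of the corresponding `a i +
1`; the quotients are the `v i`. -/
theorem coeff_prod_letter {l : ℕ} (φ : Fin l → ℕ → ℕ → ℚ) (a : Fin l → ℕ) (n : ℕ) :
    PowerSeries.coeff n (∏ i, letter (φ i) (a i)) =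
      ∑ v ∈ (Fintype.piFinset fun _ : Fin l => Finset.Icc 1 n) with
        ∑ i, (a i + 1) * v i = n, ∏ i, φ i (a i + 1) (v i) := by
  rw [PowerSeries.coeff_prod]
  have h0 : ∀ x : Fin l →₀ ℕ, ∏ i, PowerSeries.coeff (x i) (letter (φ i) (a i)) =
      if ∀ i, (a i + 1) ∣ x i ∧ x i ≠ 0 then ∏ i, φ i (a i + 1) (x i / (a i + 1)) else 0 := by
    intro x
    split_ifs with h
    · exact Finset.prod_congr rfl fun i _ => by simp [letter, h i]
    · push Not at h
      obtain ⟨i, hi⟩ := h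
      refine Finset.prod_eq_zero (Finset.mem_univ i) ?_
      simp only [letter, PowerSeries.coeff_mk]
      rw [if_neg]
      rintro ⟨h1, h2⟩
      exact h2 (hi h1)
  simp_rw [h0]
  rw [← Finset.sum_filter]
  refine Finset.sum_nbij' (fun x i => x i / (a i + 1))
    (fun v => Finsupp.equivFunOnFinite.symm fun i => (a i + 1) * v i) ?_ ?_ ?_ ?_ ?_
  · intro x hx
    simp only [Finset.mem_filter, Finset.mem_finsuppAntidiag, Fintype.mem_piFinset,
      Finset.mem_Icc] at hx ⊢
    obtain ⟨⟨h1, -⟩, h2⟩ := hx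
    refine ⟨fun i => ⟨?_, ?_⟩, ?_⟩
    · exact Nat.div_pos (Nat.le_of_dvd (Nat.pos_of_ne_zero (h2 i).2) (h2 i).1) (Nat.succ_pos _)
    · refine (Nat.div_le_self _ _).trans (h1 ▸ ?_)
      exact Finset.single_le_sum (f := fun i => x i) (fun _ _ => Nat.zero_le _)
        (Finset.mem_univ i)
    · rw [← h1]
      exact Finset.sum_congr rfl fun i _ => Nat.mul_div_cancel' (h2 i).1
  · intro v hv
    simp only [Finset.mem_filter, Finset.mem_finsuppAntidiag, Fintype.mem_piFinset,
      Finset.mem_Icc] at hv ⊢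
    refine ⟨⟨by simpa using hv.2, Finset.subset_univ _⟩, fun i => ⟨by simp, ?_⟩⟩
    have := (hv.1 i).1
    simp
    omega
  · intro x hx
    simp only [Finset.mem_filter] at hx
    ext i
    simp [Nat.mul_div_cancel' (hx.2 i).1]
  · intro v hv
    ext i
    simp
  · intro x hx
    rfl

/-- Summation: the `N`-th term of `sumBelow h` is `∑_{a < N} h a`. -/
noncomputable def sumBelow : (ℕ → ℚ⟦X⟧) →ₗ[ℚ] (ℕ → ℚ⟦X⟧) where
  toFun h N := ∑ a ∈ Finset.range N, h a
  map_add' f g := by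
    ext1 N
    simp [Finset.sum_add_distrib]
  map_smul' c f := by
    ext1 N
    simp [Finset.smul_sum]

theorem sumBelow_apply (h : ℕ → ℚ⟦X⟧) (N : ℕ) :
    sumBelow h N = ∑ a ∈ Finset.range N, h a := rfl

theorem eq_sumBelow_iff {f h : ℕ → ℚ⟦X⟧} (h0 : f 0 = 0) (hs : ∀ N, f (N + 1) = f N + h N) :
    f = sumBelow h := by
  ext1 N
  induction N with
  | zero => simp [h0, sumBelow_apply]
  | succ N ih => rw [hs, ih, sumBelow_apply, sumBelow_apply, Finset.sum_range_succ]

theorem sumBelow_zero (h : ℕ → ℚ⟦X⟧) : sumBelow h 0 = 0 := by simp [sumBelow_apply]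

theorem sumBelow_succ (h : ℕ → ℚ⟦X⟧) (N : ℕ) : sumBelow h (N + 1) = sumBelow h N + h N := by
  simp [sumBelow_apply, Finset.sum_range_succ]

/-- Summation by parts. -/
theorem sumBelow_mul_sumBelow (g h : ℕ → ℚ⟦X⟧) :
    sumBelow g * sumBelow h = sumBelow (g * sumBelow h + sumBelow g * h + g * h) := by
  refine eq_sumBelow_iff (by simp [sumBelow_zero]) fun N => ?_
  simp only [Pi.mul_apply, Pi.add_apply, sumBelow_succ]
  ring

/-- The iterated sums `∑_{N > a₁ > ⋯ > a_l} g₁(a₁) ⋯ g_l(a_l)`. -/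
noncomputable def nested : List (ℕ → ℚ⟦X⟧) → ℕ → ℚ⟦X⟧
  | [] => 1
  | g :: w => sumBelow (g * nested w)

theorem nested_ofFn {l : ℕ} (g : Fin l → ℕ → ℚ⟦X⟧) (N : ℕ) :
    nested (List.ofFn g) N =
      ∑ a ∈ (Fintype.piFinset fun _ : Fin l => Finset.range N) with
        (∀ i j : Fin l, i < j → a j < a i), ∏ i, g i (a i) := by
  induction l generalizing N with
  | zero => simp [nested]
  | succ l ih =>
    rw [List.ofFn_succ, nested, sumBelow_apply]
    simp only [Pi.mul_apply, ih, Finset.mul_sum]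
    rw [Finset.sum_sigma']
    refine Finset.sum_nbij' (fun p => Fin.cons p.1 p.2) (fun a => ⟨a 0, Fin.tail a⟩)
      ?_ ?_ ?_ ?_ ?_
    · rintro ⟨b, a⟩ h
      simp only [Finset.mem_sigma, Finset.mem_range, Finset.mem_filter,
        Fintype.mem_piFinset] at h ⊢
      obtain ⟨h1, h2, h3⟩ := h
      refine ⟨fun i => ?_, fun i j hij => ?_⟩
      · refine Fin.cases (by simpa using h1) (fun i => ?_) i
        simpa using (h2 i).trans h1
      · induction j using Fin.cases with
        | zero => exact absurd hij (Fin.not_lt_zero _)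
        | succ j =>
          induction i using Fin.cases with
          | zero => simpa using h2 j
          | succ i => simpa using h3 i j (by simpa using hij)
    · intro a h
      simp only [Finset.mem_sigma, Finset.mem_range, Finset.mem_filter,
        Fintype.mem_piFinset] at h ⊢
      exact ⟨h.1 0, fun i => h.2 0 i.succ (Fin.succ_pos i),
        fun i j hij => h.2 _ _ (Fin.succ_lt_succ_iff.2 hij)⟩
    · rintro ⟨b, a⟩ h
      simp
    · intro a h
      simp
    · rintro ⟨b, a⟩ h
      simp [Fin.prod_univ_succ]

/-- The sequence `f` of power series stabilises to `F`. -/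
def StabilizesTo (f : ℕ → ℚ⟦X⟧) (F : ℚ⟦X⟧) : Prop :=
  ∀ n N, n ≤ N → PowerSeries.coeff n (f N) = PowerSeries.coeff n F

namespace StabilizesTo

theorem unique {f : ℕ → ℚ⟦X⟧} {F G : ℚ⟦X⟧} (hF : StabilizesTo f F) (hG : StabilizesTo f G) :
    F = G := by
  ext n
  rw [← hF n n le_rfl, hG n n le_rfl]

theorem zero : StabilizesTo 0 0 := fun n N _ => by simp

theorem add {f g : ℕ → ℚ⟦X⟧} {F G : ℚ⟦X⟧} (hF : StabilizesTo f F) (hG : StabilizesTo g G) :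
    StabilizesTo (f + g) (F + G) := fun n N h => by simp [hF n N h, hG n N h]

theorem sub {f g : ℕ → ℚ⟦X⟧} {F G : ℚ⟦X⟧} (hF : StabilizesTo f F) (hG : StabilizesTo g G) :
    StabilizesTo (f - g) (F - G) := fun n N h => by simp [hF n N h, hG n N h]

theorem smul {f : ℕ → ℚ⟦X⟧} {F : ℚ⟦X⟧} (c : ℚ) (hF : StabilizesTo f F) :
    StabilizesTo (c • f) (c • F) := fun n N h => by simp [hF n N h]

theorem mul {f g : ℕ → ℚ⟦X⟧} {F G : ℚ⟦X⟧} (hF : StabilizesTo f F) (hG : StabilizesTo g G) :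
    StabilizesTo (f * g) (F * G) := fun n N h => by
  rw [Pi.mul_apply, PowerSeries.coeff_mul, PowerSeries.coeff_mul]
  refine Finset.sum_congr rfl fun p hp => ?_
  have := Finset.HasAntidiagonal.mem_antidiagonal.1 hp
  rw [hF _ N (by omega), hG _ N (by omega)]

end StabilizesTo

theorem coeff_d (F : ℚ⟦X⟧) (n : ℕ) :
    PowerSeries.coeff n (d F) = n * PowerSeries.coeff n F := by
  cases n with
  | zero => simp [d]
  | succ n =>
    simp only [d, Derivation.smul_apply, smul_eq_mul, PowerSeries.coeff_succ_X_mul]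
    rw [PowerSeries.coeff_derivative]
    push_cast
    ring

theorem StabilizesTo.derivation {f : ℕ → ℚ⟦X⟧} {F : ℚ⟦X⟧} (hF : StabilizesTo f F) :
    StabilizesTo (fun N => d (f N)) (d F) := fun n N h => by
  simp only [coeff_d, hF n N h]

/-- Nested sums of letters stabilise to multiple divisor sum series. -/
theorem stabilizesTo_nested_letter {l : ℕ} (φ : Fin l → ℕ → ℕ → ℚ) :
    StabilizesTo (nested (List.ofFn fun i => letter (φ i)))
      (PowerSeries.mk fun n => ∑ p ∈ divisorPairs l n, ∏ i, φ i (p.1 i) (p.2 i)) := by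
  intro n N hN
  rw [nested_ofFn, map_sum, PowerSeries.coeff_mk]
  simp_rw [coeff_prod_letter]
  rw [Finset.sum_sigma']
  refine Finset.sum_nbij' (fun p => (fun i => p.1 i + 1, p.2))
    (fun p => ⟨fun i => p.1 i - 1, p.2⟩) ?_ ?_ ?_ ?_ ?_
  · rintro ⟨a, v⟩ h
    simp only [Finset.mem_sigma, Finset.mem_range, Finset.mem_filter,
        Fintype.mem_piFinset, Finset.mem_Icc, mem_divisorPairs] at h ⊢
    obtain ⟨⟨h1, h2⟩, h3, h4⟩ := h
    exact ⟨fun i => Nat.succ_pos _, fun i => (h3 i).1,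
      fun i j hij => Nat.succ_lt_succ (h2 i j hij), h4⟩
  · rintro ⟨u, v⟩ h
    have h' := h
    rw [mem_divisorPairs] at h'
    simp only [divisorPairs, Finset.mem_sigma, Finset.mem_range, Finset.mem_filter,
        Fintype.mem_piFinset, Finset.mem_Icc, Finset.mem_product] at h h' ⊢
    obtain ⟨⟨h1, h2⟩, h3, h4⟩ := h
    -- Since `u i ≤ n ≤ N`, the index `u i - 1` lies below `N`: the `n`-th coefficient is already
    -- final.
    refine ⟨⟨fun i => ?_, fun i j hij => ?_⟩, h2, ?_⟩
    · have := h1 i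
      omega
    · have := h3 i j hij
      have := h1 j
      omega
    · rw [← h4]
      refine Finset.sum_congr rfl fun i _ => ?_
      rw [Nat.sub_add_cancel (h1 i).1]
  · rintro ⟨a, v⟩ h
    simp
  · rintro ⟨u, v⟩ h
    rw [mem_divisorPairs] at h
    ext i
    · exact Nat.sub_add_cancel (h.1 i)
    · rfl
  · rintro ⟨a, v⟩ h
    rfl

/-! ### Products of letters -/

/-- The sequence of the series `∑_{v > 0} v^{s-1}/(s-1)! q^{uv}`, where `u = a + 1`. -/
noncomputable def bracketLetter (s : ℕ) : ℕ → ℚ⟦X⟧ :=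
  letter fun _ v => (v : ℚ) ^ (s - 1) / ((s - 1).factorial : ℚ)

/-- The derivation `u⁻¹ d` in the term with `u = a + 1`. -/
noncomputable def scaledD : (ℕ → ℚ⟦X⟧) →ₗ[ℚ] (ℕ → ℚ⟦X⟧) where
  toFun f a := ((a : ℚ) + 1)⁻¹ • d (f a)
  map_add' f g := by
    ext1 a
    simp
  map_smul' c f := by
    ext1 a
    simp [smul_comm c]

theorem scaledD_apply (f : ℕ → ℚ⟦X⟧) (a : ℕ) : scaledD f a = ((a : ℚ) + 1)⁻¹ • d (f a) := rfl

theorem scaledD_mul (f g : ℕ → ℚ⟦X⟧) : scaledD (f * g) = scaledD f * g + f * scaledD g := by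
  ext1 a
  simp only [scaledD_apply, Pi.mul_apply, Pi.add_apply, Derivation.leibniz, smul_add,
    smul_eq_mul, mul_smul_comm, smul_mul_assoc]
  ring_nf

theorem scaledD_one : scaledD 1 = 0 := by
  ext1 a
  simp [scaledD_apply]

theorem scaledD_pow_succ (f : ℕ → ℚ⟦X⟧) (n : ℕ) :
    scaledD (f ^ (n + 1)) = ((n : ℚ) + 1) • (f ^ n * scaledD f) := by
  induction n with
  | zero => simp
  | succ n ih =>
    rw [pow_succ, scaledD_mul, ih]
    push_cast
    rw [smul_mul_assoc, show f ^ n * scaledD f * f = f ^ (n + 1) * scaledD f by ring]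
    module

theorem scaledD_bracketLetter (s : ℕ) :
    scaledD (bracketLetter (s + 1)) = ((s : ℚ) + 1) • bracketLetter (s + 2) := by
  ext a n
  simp only [scaledD_apply, bracketLetter, letter, Pi.smul_apply, map_smul, coeff_d,
    PowerSeries.coeff_mk, smul_eq_mul]
  split_ifs with h
  · obtain ⟨⟨m, rfl⟩, -⟩ := h
    rw [Nat.mul_div_cancel_left _ (Nat.succ_pos a)]
    have : (s.factorial : ℚ) ≠ 0 := by positivity
    simp only [Nat.add_sub_cancel, show s + 2 - 1 = s + 1 by omega, Nat.factorial_succ]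
    push_cast
    field_simp
    ring
  · simp

/-- The geometric series `L_1 = x/(1-x)` with `x = q^{a+1}`. -/
theorem bracketLetter_one_mul (a : ℕ) :
    bracketLetter 1 a * (1 - PowerSeries.X ^ (a + 1)) = PowerSeries.X ^ (a + 1) := by
  ext n
  rw [mul_sub, mul_one, map_sub, PowerSeries.coeff_mul_X_pow', PowerSeries.coeff_X_pow]
  simp only [bracketLetter, letter, PowerSeries.coeff_mk]
  by_cases h : a + 1 ≤ n
  · obtain ⟨m, rfl⟩ := Nat.exists_eq_add_of_le h
    by_cases hm : m = 0
    · simp [hm]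
    · simp [hm]
  · have h1 : n ≠ a + 1 := by omega
    have h2 : ¬ ((a + 1) ∣ n ∧ n ≠ 0) := fun h' =>
      h (Nat.le_of_dvd (Nat.pos_of_ne_zero h'.2) h'.1)
    simp [h, h1, h2]

theorem scaledD_X_pow (a : ℕ) :
    ((a : ℚ) + 1)⁻¹ • d (PowerSeries.X ^ (a + 1)) = PowerSeries.X ^ (a + 1) := by
  ext n
  rw [map_smul, coeff_d, PowerSeries.coeff_X_pow]
  split_ifs with h
  · subst h
    have : (a : ℚ) + 1 ≠ 0 := by positivity
    simp [this]
  · simp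

/-- Applying `x d/dx` to `L_1 (1 - x) = x` gives `L_2 (1 - x) = x (1 + L_1)`, and `x = L_1 (1 - x)`;
then `1 - x` cancels. -/
theorem bracketLetter_two : bracketLetter 2 = bracketLetter 1 + bracketLetter 1 ^ 2 := by
  have h := scaledD_bracketLetter 0
  simp only [zero_add, Nat.cast_zero, one_smul] at h
  rw [← h]
  ext1 a
  have h1 := bracketLetter_one_mul a
  have h2 := congrArg (fun F => ((a : ℚ) + 1)⁻¹ • d F) h1
  simp only [scaledD_X_pow, Derivation.leibniz, smul_add, map_sub, Derivation.map_one_eq_zero,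
    smul_eq_mul, zero_sub] at h2
  have h3 : (1 - PowerSeries.X ^ (a + 1) : ℚ⟦X⟧) ≠ 0 := by
    intro h0
    have := congrArg (PowerSeries.coeff 0) h0
    simp at this
  refine mul_right_cancel₀ h3 ?_
  rw [mul_neg, smul_neg, ← mul_smul_comm, scaledD_X_pow, ← mul_smul_comm] at h2
  rw [scaledD_apply, Pi.add_apply, Pi.pow_apply]
  linear_combination h2 - (1 + bracketLetter 1 a) * h1

/-- The sequence `1/2 + ∑_{v > 0} q^{uv}`, in which the letters are polynomials. -/
noncomputable def symLetter : ℕ → ℚ⟦X⟧ := bracketLetter 1 + (1 / 2 : ℚ) • 1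

theorem bracketLetter_two_eq : bracketLetter 2 = symLetter ^ 2 - (1 / 4 : ℚ) • 1 := by
  rw [bracketLetter_two, symLetter, add_sq]
  simp only [smul_pow, one_pow, mul_smul_comm, mul_one]
  have : (2 : ℕ → ℚ⟦X⟧) * bracketLetter 1 = (2 : ℚ) • bracketLetter 1 := by
    rw [two_mul, two_smul]
  rw [this, smul_smul]
  norm_num
  module

theorem scaledD_symLetter : scaledD symLetter = bracketLetter 2 := by
  have h := scaledD_bracketLetter 0
  simp only [zero_add, Nat.cast_zero, one_smul] at h
  rw [symLetter, map_add, map_smul, scaledD_one, h, smul_zero, add_zero]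

theorem scaledD_bracketLetter_two :
    scaledD (bracketLetter 2) = (2 : ℚ) • (bracketLetter 2 * symLetter) := by
  rw [bracketLetter_two_eq, map_sub, map_smul, scaledD_one, scaledD_pow_succ symLetter 1,
    scaledD_symLetter, bracketLetter_two_eq]
  simp only [smul_zero, sub_zero, pow_one, mul_comm symLetter]
  norm_num

/-- The span of the letters `L_j` with `2 ≤ j ≤ i + 2` and `j ≡ i mod 2`. -/
noncomputable def parityLetters (i : ℕ) : Submodule ℚ (ℕ → ℚ⟦X⟧) :=
  Submodule.span ℚ {f | ∃ j, 2 ≤ j ∧ j ≤ i + 2 ∧ (Even j ↔ Even i) ∧ f = bracketLetter j}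

/-- The span of the `L_2 w ^ j` with `j ≤ i` and `j ≡ i mod 2`. -/
noncomputable def parityPowers (i : ℕ) : Submodule ℚ (ℕ → ℚ⟦X⟧) :=
  Submodule.span ℚ {f | ∃ j, j ≤ i ∧ (Even j ↔ Even i) ∧ f = bracketLetter 2 * symLetter ^ j}

theorem parityLetters_mono {i j : ℕ} (h : i ≤ j) (hp : Even i ↔ Even j) :
    parityLetters i ≤ parityLetters j := by
  refine Submodule.span_mono ?_
  rintro f ⟨k, h1, h2, h3, rfl⟩
  exact ⟨k, h1, by omega, h3.trans hp, rfl⟩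

theorem scaledD_mem_parityLetters {i : ℕ} {f : ℕ → ℚ⟦X⟧} (hf : f ∈ parityLetters i) :
    scaledD f ∈ parityLetters (i + 1) := by
  suffices parityLetters i ≤ (parityLetters (i + 1)).comap scaledD from this hf
  refine Submodule.span_le.2 ?_
  rintro f ⟨j, h1, h2, h3, rfl⟩
  obtain ⟨j, rfl⟩ := Nat.exists_eq_add_of_le' (show 1 ≤ j by omega)
  simp only [Submodule.comap_coe, Set.mem_preimage, SetLike.mem_coe, scaledD_bracketLetter]
  refine Submodule.smul_mem _ _ (Submodule.subset_span ⟨j + 2, by omega, by omega, ?_, rfl⟩)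
  rw [show j + 2 = (j + 1) + 1 from rfl, Nat.even_add_one, h3, Nat.even_add_one]

/-- The three-term recursion that passes between letters and powers of `w`. It follows from `D L_2 =
2 L_2 w` and `D w = w² - 1/4`, and its steps by two in the exponent are what preserves parity. -/
theorem scaledD_two_mul_symLetter_pow (i : ℕ) :
    scaledD (bracketLetter 2 * symLetter ^ (i + 1)) =
      ((i : ℚ) + 3) • (bracketLetter 2 * symLetter ^ (i + 2)) -
        (((i : ℚ) + 1) / 4) • (bracketLetter 2 * symLetter ^ i) := by
  rw [scaledD_mul, scaledD_bracketLetter_two, scaledD_pow_succ, scaledD_symLetter]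
  nth_rw 3 [bracketLetter_two_eq]
  simp only [mul_sub, mul_smul_comm, smul_mul_assoc, mul_one, smul_sub, smul_smul]
  rw [show bracketLetter 2 * symLetter * symLetter ^ (i + 1) = 
    bracketLetter 2 * symLetter ^ (i + 2) by ring, show bracketLetter 2 * (symLetter ^ i * 
    symLetter ^ 2) = bracketLetter 2 * symLetter ^ (i + 2) by ring]
  module

/-- The recursion is solved for `L_2 w^{i+2}`, which is possible because its coefficient `i + 3` is
nonzero. -/
theorem two_mul_symLetter_pow_mem (i : ℕ) :
    bracketLetter 2 * symLetter ^ i ∈ parityLetters i := by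
  induction i using Nat.strong_induction_on with
  | _ i ih =>
    match i with
    | 0 =>
      rw [pow_zero, mul_one]
      exact Submodule.subset_span ⟨2, le_rfl, le_rfl, by decide, rfl⟩
    | 1 =>
      have h := scaledD_mem_parityLetters (ih 0 (by omega))
      rw [pow_zero, mul_one, scaledD_bracketLetter_two] at h
      rw [pow_one]
      simpa using Submodule.smul_mem _ (2⁻¹ : ℚ) h
    | i + 2 =>
      have h1 := scaledD_mem_parityLetters (ih (i + 1) (by omega))
      have h2 := parityLetters_mono (show i ≤ i + 2 by omega) (by simp [Nat.even_add])
        (ih i (by omega))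
      rw [scaledD_two_mul_symLetter_pow] at h1
      have h3 := Submodule.add_mem _ h1 (Submodule.smul_mem _ (((i : ℚ) + 1) / 4) h2)
      rw [sub_add_cancel] at h3
      have h4 : (i : ℚ) + 3 ≠ 0 := by positivity
      simpa [smul_smul, h4] using Submodule.smul_mem _ (((i : ℚ) + 3)⁻¹) h3

theorem scaledD_mem_parityPowers {i : ℕ} {f : ℕ → ℚ⟦X⟧} (hf : f ∈ parityPowers i) :
    scaledD f ∈ parityPowers (i + 1) := by
  suffices parityPowers i ≤ (parityPowers (i + 1)).comap scaledD from this hf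
  refine Submodule.span_le.2 ?_
  rintro f ⟨j, h1, h2, rfl⟩
  simp only [Submodule.comap_coe, Set.mem_preimage, SetLike.mem_coe]
  match j with
  | 0 =>
    rw [pow_zero, mul_one, scaledD_bracketLetter_two]
    refine Submodule.smul_mem _ _ (Submodule.subset_span ⟨1, by omega, ?_, by rw [pow_one]⟩)
    simp only [Nat.even_add_one, ← h2]
  | j + 1 =>
    rw [scaledD_two_mul_symLetter_pow]
    rw [Nat.even_add_one] at h2
    refine Submodule.sub_mem _ (Submodule.smul_mem _ _ (Submodule.subset_span
      ⟨j + 2, by omega, ?_, rfl⟩)) (Submodule.smul_mem _ _ (Submodule.subset_span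
      ⟨j, by omega, ?_, rfl⟩))
    · simp only [Nat.even_add_one, ← h2]
    · simp only [Nat.even_add_one, ← h2, not_not]

theorem bracketLetter_mem_parityPowers (i : ℕ) : bracketLetter (i + 2) ∈ parityPowers i := by
  induction i with
  | zero => exact Submodule.subset_span ⟨0, le_rfl, Iff.rfl, by simp⟩
  | succ i ih =>
    have h := scaledD_mem_parityPowers ih
    rw [show i + 2 = (i + 1) + 1 from rfl, scaledD_bracketLetter] at h
    have h4 : ((i + 1 : ℕ) : ℚ) + 1 ≠ 0 := by positivity
    have := Submodule.smul_mem _ ((((i + 1 : ℕ) : ℚ) + 1)⁻¹) h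
    rwa [smul_smul, inv_mul_cancel₀ h4, one_smul] at this

theorem mul_mem_of_span {A : Type*} [CommRing A] [Algebra ℚ A] {s t : Set A}
    {V : Submodule ℚ A} (h : ∀ f ∈ s, ∀ g ∈ t, f * g ∈ V) {f g : A}
    (hf : f ∈ Submodule.span ℚ s) (hg : g ∈ Submodule.span ℚ t) : f * g ∈ V := by
  have := Submodule.mul_mem_mul hf hg
  rw [Submodule.span_mul_span] at this
  refine Submodule.span_le.2 ?_ this
  rintro _ ⟨f, hf, g, hg, rfl⟩
  exact h f hf g hg

/-- In terms of `w` both factors are `L_2` times polynomials. Rewriting one `L_2` as `w² - 1/4`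
leaves `L_2` times a polynomial in `w`, which expands back into letters of the right parity. -/
theorem bracketLetter_mul_mem_parityLetters (i j : ℕ) :
    bracketLetter (i + 2) * bracketLetter (j + 2) ∈ parityLetters (i + j + 2) := by
  refine mul_mem_of_span ?_ (bracketLetter_mem_parityPowers i) (bracketLetter_mem_parityPowers j)
  rintro _ ⟨a, ha, ha', rfl⟩ _ ⟨b, hb, hb', rfl⟩
  have hp : Even (a + b) ↔ Even (i + j + 2) := by
    simp [Nat.even_add, ha', hb']
  have : bracketLetter 2 * symLetter ^ a * (bracketLetter 2 * symLetter ^ b) =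
      bracketLetter 2 * symLetter ^ (a + b + 2) -
        (1 / 4 : ℚ) • (bracketLetter 2 * symLetter ^ (a + b)) := by
    nth_rw 2 [bracketLetter_two_eq]
    simp only [sub_mul, mul_sub, smul_mul_assoc, one_mul, mul_smul_comm]
    congr 1
    · ring
    · congr 1
      ring
  rw [this]
  refine Submodule.sub_mem _ (parityLetters_mono (i := a + b + 2) (by omega) ?_
    (two_mul_symLetter_pow_mem _)) (Submodule.smul_mem _ _
    (parityLetters_mono (by omega) hp (two_mul_symLetter_pow_mem _)))
  rw [← hp]
  simp [Nat.even_add]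

/-- The span of the letters `L_j` with `j ∈ S` and `j ≤ k`. -/
noncomputable def letterSpan (S : Set ℕ) (k : ℕ) : Submodule ℚ (ℕ → ℚ⟦X⟧) :=
  Submodule.span ℚ {f | ∃ j ∈ S, j ≤ k ∧ f = bracketLetter j}

theorem bracketLetter_mem_letterSpan {S : Set ℕ} {j k : ℕ} (hj : j ∈ S) (hk : j ≤ k) :
    bracketLetter j ∈ letterSpan S k :=
  Submodule.subset_span ⟨j, hj, hk, rfl⟩

/-- A set of letters is closed if products of its letters are combinations of its letters,
of at most the expected weight. -/
def ClosedLetters (S : Set ℕ) : Prop :=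
  (∀ a ∈ S, 0 < a) ∧
    ∀ a ∈ S, ∀ b ∈ S, bracketLetter a * bracketLetter b ∈ letterSpan S (a + b)

theorem parityLetters_le_letterSpan {S : Set ℕ} {i k : ℕ} (hk : i + 2 ≤ k)
    (hS : ∀ j, 2 ≤ j → (Even j ↔ Even i) → j ∈ S) : parityLetters i ≤ letterSpan S k := by
  refine Submodule.span_le.2 ?_
  rintro f ⟨j, h1, h2, h3, rfl⟩
  exact bracketLetter_mem_letterSpan (hS j h1 h3) (h2.trans hk)

theorem closedLetters_even : ClosedLetters {s | 0 < s ∧ Even s} := by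
  refine ⟨fun a ha => ha.1, ?_⟩
  rintro a ⟨ha, ha'⟩ b ⟨hb, hb'⟩
  have h2a : 2 ≤ a := by
    obtain ⟨c, rfl⟩ := ha'
    omega
  have h2b : 2 ≤ b := by
    obtain ⟨c, rfl⟩ := hb'
    omega
  obtain ⟨i, rfl⟩ := Nat.exists_eq_add_of_le' h2a
  obtain ⟨j, rfl⟩ := Nat.exists_eq_add_of_le' h2b
  have hj : Even j := by simpa [Nat.even_add] using hb'
  have hij : Even (i + j + 2) := by
    rw [show i + j + 2 = i + 2 + j by omega]
    exact ha'.add hj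
  exact parityLetters_le_letterSpan (S := {s | 0 < s ∧ Even s}) (by omega)
    (fun c hc hc' => ⟨Nat.zero_lt_of_lt hc, hc'.2 hij⟩)
    (bracketLetter_mul_mem_parityLetters i j)

theorem closedLetters_one_lt : ClosedLetters {s | 1 < s} := by
  refine ⟨fun a ha => Nat.zero_lt_of_lt ha, fun a ha b hb => ?_⟩
  obtain ⟨i, rfl⟩ := Nat.exists_eq_add_of_le' (show 2 ≤ a from ha)
  obtain ⟨j, rfl⟩ := Nat.exists_eq_add_of_le' (show 2 ≤ b from hb)
  exact parityLetters_le_letterSpan (by omega) (fun c hc hc' => hc)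
    (bracketLetter_mul_mem_parityLetters i j)

/-- As `L_1 = w - 1/2` and the other factor is divisible by `L_2`, the product stays divisible by
`L_2`, so `L_1` does not occur in it. Admissible brackets rely on this. -/
theorem bracketLetter_one_mul_mem (j : ℕ) :
    bracketLetter 1 * bracketLetter (j + 2) ∈ letterSpan {s | 1 < s} (1 + (j + 2)) := by
  have h1 : bracketLetter 1 = symLetter - (1 / 2 : ℚ) • 1 := by
    rw [symLetter, add_sub_cancel_right]
  rw [h1, sub_mul, smul_mul_assoc, one_mul]
  refine Submodule.sub_mem _ ?_ (Submodule.smul_mem _ _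
    (bracketLetter_mem_letterSpan (by simp) (by omega)))
  rw [← pow_one symLetter]
  refine mul_mem_of_span (s := {symLetter ^ 1}) ?_ (Submodule.subset_span rfl)
    (bracketLetter_mem_parityPowers j)
  rintro _ rfl _ ⟨b, hb, hb', rfl⟩
  have : symLetter ^ 1 * (bracketLetter 2 * symLetter ^ b) =
    bracketLetter 2 * symLetter ^ (b + 1) := by ring
  rw [this]
  exact parityLetters_le_letterSpan (by omega) (fun c hc hc' => hc)
    (two_mul_symLetter_pow_mem _)

theorem letterSpan_mono {S T : Set ℕ} (h : S ⊆ T) (k : ℕ) : letterSpan S k ≤ letterSpan T k := by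
  refine Submodule.span_mono ?_
  rintro f ⟨j, h1, h2, rfl⟩
  exact ⟨j, h h1, h2, rfl⟩

theorem closedLetters_pos : ClosedLetters {s | 0 < s} := by
  refine ⟨fun a ha => ha, fun a ha b hb => ?_⟩
  have hsub : ({s | 1 < s} : Set ℕ) ⊆ {s | 0 < s} := fun s hs => Nat.zero_lt_of_lt hs
  rcases eq_or_ne a 1 with rfl | ha1
  · rcases eq_or_ne b 1 with rfl | hb1
    · have : bracketLetter 1 * bracketLetter 1 = bracketLetter 2 - bracketLetter 1 := by
        rw [bracketLetter_two]
        ring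
      rw [this]
      exact Submodule.sub_mem _ (bracketLetter_mem_letterSpan (by simp) le_rfl)
        (bracketLetter_mem_letterSpan (by simp) (by omega))
    · have hb' : 0 < b := hb
      obtain ⟨j, rfl⟩ := Nat.exists_eq_add_of_le' (show 2 ≤ b by omega)
      exact letterSpan_mono hsub _ (bracketLetter_one_mul_mem j)
  · have ha' : 0 < a := ha
    obtain ⟨i, rfl⟩ := Nat.exists_eq_add_of_le' (show 2 ≤ a by omega)
    rcases eq_or_ne b 1 with rfl | hb1
    · rw [mul_comm, add_comm]
      exact letterSpan_mono hsub _ (bracketLetter_one_mul_mem i)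
    · have hb' : 0 < b := hb
      obtain ⟨j, rfl⟩ := Nat.exists_eq_add_of_le' (show 2 ≤ b by omega)
      exact letterSpan_mono hsub _ (closedLetters_one_lt.2 _ (by simp) _ (by simp))

theorem bracketLetter_mul_mem_one_lt {a b : ℕ} (ha : 1 < a) (hb : 0 < b) :
    bracketLetter a * bracketLetter b ∈ letterSpan {s | 1 < s} (a + b) := by
  obtain ⟨i, rfl⟩ := Nat.exists_eq_add_of_le' (show 2 ≤ a from ha)
  rcases eq_or_ne b 1 with rfl | hb1
  · rw [mul_comm, add_comm]
    exact bracketLetter_one_mul_mem i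
  · exact closedLetters_one_lt.2 _ ha _ (show 1 < b by omega)

/-! ### The quasi-shuffle product and the subalgebras of brackets -/

/-- The sequences of power series that stabilise to an element of `V`. -/
def stabilizingTo (V : Submodule ℚ ℚ⟦X⟧) : Submodule ℚ (ℕ → ℚ⟦X⟧) where
  carrier := {f | ∃ F ∈ V, StabilizesTo f F}
  zero_mem' := ⟨0, V.zero_mem, .zero⟩
  add_mem' := by
    rintro f g ⟨F, hF, hf⟩ ⟨G, hG, hg⟩
    exact ⟨F + G, V.add_mem hF hG, hf.add hg⟩
  smul_mem' := by
    rintro c f ⟨F, hF, hf⟩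
    exact ⟨c • F, V.smul_mem c hF, hf.smul c⟩

theorem StabilizesTo.mem {V : Submodule ℚ ℚ⟦X⟧} {f : ℕ → ℚ⟦X⟧} {F : ℚ⟦X⟧}
    (hF : StabilizesTo f F) (hf : f ∈ stabilizingTo V) : F ∈ V := by
  obtain ⟨G, hG, hfG⟩ := hf
  rwa [hF.unique hfG]

/-- The truncations of the bracket of the word `w`. -/
noncomputable def wordSeq (w : List ℕ) : ℕ → ℚ⟦X⟧ := nested (w.map bracketLetter)

theorem wordSeq_nil : wordSeq [] = 1 := rfl

theorem wordSeq_cons (s : ℕ) (w : List ℕ) :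
    wordSeq (s :: w) = sumBelow (bracketLetter s * wordSeq w) := rfl

theorem stabilizesTo_wordSeq {l : ℕ} (s : Fin l → ℕ) :
    StabilizesTo (wordSeq (List.ofFn s)) (bracket s) := by
  have h := stabilizesTo_nested_letter
    fun (i : Fin l) (_ v : ℕ) => (v : ℚ) ^ (s i - 1) / ((s i - 1).factorial : ℚ)
  rw [wordSeq, List.map_ofFn]
  refine (?_ : bracket s = _) ▸ h
  ext n
  simp only [bracket, multipleDivisorSum, PowerSeries.coeff_mk, Finset.prod_div_distrib]
  rw [← Finset.sum_div]
  push_cast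
  rfl

theorem wordSeq_mem_stabilizingTo {V : Submodule ℚ ℚ⟦X⟧} {w : List ℕ}
    (h : bracket (fun i : Fin w.length => w.get i) ∈ V) : wordSeq w ∈ stabilizingTo V := by
  refine ⟨_, h, ?_⟩
  have := stabilizesTo_wordSeq fun i : Fin w.length => w.get i
  rwa [List.ofFn_get] at this

/-- The span of the truncated brackets of weight at most `k` with letters in `S`. -/
noncomputable def wordSpan (S : Set ℕ) (k : ℕ) : Submodule ℚ (ℕ → ℚ⟦X⟧) :=
  Submodule.span ℚ {f | ∃ w : List ℕ, (∀ s ∈ w, s ∈ S) ∧ w.sum ≤ k ∧ f = wordSeq w}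

theorem wordSeq_mem_wordSpan {S : Set ℕ} {k : ℕ} {w : List ℕ} (hS : ∀ s ∈ w, s ∈ S)
    (hk : w.sum ≤ k) : wordSeq w ∈ wordSpan S k :=
  Submodule.subset_span ⟨w, hS, hk, rfl⟩

theorem wordSpan_mono (S : Set ℕ) {k m : ℕ} (h : k ≤ m) : wordSpan S k ≤ wordSpan S m := by
  refine Submodule.span_mono ?_
  rintro f ⟨w, h1, h2, rfl⟩
  exact ⟨w, h1, h2.trans h, rfl⟩

theorem sumBelow_mul_mem {T S : Set ℕ} {m k : ℕ} {V : Submodule ℚ (ℕ → ℚ⟦X⟧)}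
    (h : ∀ j ∈ T, j ≤ m → ∀ w : List ℕ, (∀ s ∈ w, s ∈ S) → w.sum ≤ k → wordSeq (j :: w) ∈ V)
    {g f : ℕ → ℚ⟦X⟧} (hg : g ∈ letterSpan T m) (hf : f ∈ wordSpan S k) :
    sumBelow (g * f) ∈ V := by
  refine mul_mem_of_span (V := V.comap sumBelow) ?_ hg hf
  rintro _ ⟨j, hj, hjm, rfl⟩ _ ⟨w, hw, hwk, rfl⟩
  exact h j hj hjm w hw hwk

theorem sumBelow_mul_mem_wordSpan {S : Set ℕ} {m k : ℕ} {g f : ℕ → ℚ⟦X⟧}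
    (hg : g ∈ letterSpan S m) (hf : f ∈ wordSpan S k) :
    sumBelow (g * f) ∈ wordSpan S (m + k) := by
  refine sumBelow_mul_mem (fun j hj hjm w hw hwk => wordSeq_mem_wordSpan ?_ ?_) hg hf
  · simpa using ⟨hj, hw⟩
  · rw [List.sum_cons]
    omega

/-- The quasi-shuffle recursion: the larger of the two outermost summation indices comes from the
first word, from the second, or they coincide and the letters multiply. -/
theorem wordSeq_cons_mul_cons (a b : ℕ) (v w : List ℕ) :
    wordSeq (a :: v) * wordSeq (b :: w) =
      sumBelow (bracketLetter a * (wordSeq v * wordSeq (b :: w))) +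
        sumBelow (bracketLetter b * (wordSeq (a :: v) * wordSeq w)) +
        sumBelow (bracketLetter a * bracketLetter b * (wordSeq v * wordSeq w)) := by
  rw [wordSeq_cons, wordSeq_cons, sumBelow_mul_sumBelow, ← map_add, ← map_add]
  congr 1
  ring

theorem wordSeq_mul_mem {S : Set ℕ} (hS : ClosedLetters S) (v w : List ℕ)
    (hv : ∀ s ∈ v, s ∈ S) (hw : ∀ s ∈ w, s ∈ S) :
    wordSeq v * wordSeq w ∈ wordSpan S (v.sum + w.sum) := by
  induction v generalizing w with
  | nil => simpa [wordSeq_nil] using wordSeq_mem_wordSpan hw le_rfl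
  | cons a v ihv =>
    induction w with
    | nil => simpa [wordSeq_nil] using wordSeq_mem_wordSpan hv le_rfl
    | cons b w ihw =>
      have ha : a ∈ S := hv a (by simp)
      have hb : b ∈ S := hw b (by simp)
      have hv' : ∀ s ∈ v, s ∈ S := fun s hs => hv s (by simp [hs])
      have hw' : ∀ s ∈ w, s ∈ S := fun s hs => hw s (by simp [hs])
      rw [wordSeq_cons_mul_cons]
      refine Submodule.add_mem _ (Submodule.add_mem _ ?_ ?_) ?_
      · exact wordSpan_mono S (by simp; omega) (sumBelow_mul_mem_wordSpan
          (bracketLetter_mem_letterSpan ha le_rfl) (ihv _ hv' hw))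
      · exact wordSpan_mono S (by simp; omega) (sumBelow_mul_mem_wordSpan
          (bracketLetter_mem_letterSpan hb le_rfl) (ihw hw'))
      · exact wordSpan_mono S (by simp; omega) (sumBelow_mul_mem_wordSpan
          (hS.2 a ha b hb) (ihv _ hv' hw'))

/-- The span of the brackets of weight at most `k` with entries in `S`. -/
noncomputable def bracketSpan (S : Set ℕ) (k : ℕ) : Submodule ℚ ℚ⟦X⟧ :=
  Submodule.span ℚ {F | ∃ (l : ℕ) (s : Fin l → ℕ), (∀ i, s i ∈ S) ∧ ∑ i, s i ≤ k ∧ F = bracket s}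

theorem bracket_mem_bracketSpan {S : Set ℕ} {l k : ℕ} {s : Fin l → ℕ} (hs : ∀ i, s i ∈ S)
    (hk : ∑ i, s i ≤ k) : bracket s ∈ bracketSpan S k :=
  Submodule.subset_span ⟨l, s, hs, hk, rfl⟩

/-- Transfers identities between truncations to the brackets themselves. -/
theorem wordSpan_le_stabilizingTo (S : Set ℕ) (k : ℕ) :
    wordSpan S k ≤ stabilizingTo (bracketSpan S k) := by
  refine Submodule.span_le.2 ?_
  rintro f ⟨w, h1, h2, rfl⟩
  refine wordSeq_mem_stabilizingTo (bracket_mem_bracketSpan (fun i => h1 _ (List.get_mem _ _)) ?_)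
  rw [← List.sum_ofFn, List.ofFn_get]
  exact h2

theorem bracket_mul_mem {S : Set ℕ} (hS : ClosedLetters S) {l m : ℕ} {s : Fin l → ℕ}
    {t : Fin m → ℕ} (hs : ∀ i, s i ∈ S) (ht : ∀ i, t i ∈ S) :
    bracket s * bracket t ∈ bracketSpan S (∑ i, s i + ∑ i, t i) := by
  refine ((stabilizesTo_wordSeq s).mul (stabilizesTo_wordSeq t)).mem
    (wordSpan_le_stabilizingTo _ _ ?_)
  rw [← List.sum_ofFn, ← List.sum_ofFn]
  refine wordSeq_mul_mem hS _ _ ?_ ?_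
  · simpa [List.forall_mem_ofFn_iff] using hs
  · simpa [List.forall_mem_ofFn_iff] using ht

theorem bracketSpan_mono {S T : Set ℕ} (hS : S ⊆ T) {k m : ℕ} (h : k ≤ m) :
    bracketSpan S k ≤ bracketSpan T m := by
  refine Submodule.span_mono ?_
  rintro f ⟨l, s, h1, h2, rfl⟩
  exact ⟨l, s, fun i => hS (h1 i), h2.trans h, rfl⟩

theorem bracketSpan_mul_mem {S : Set ℕ} (hS : ClosedLetters S) {k m : ℕ} {F G : ℚ⟦X⟧}
    (hF : F ∈ bracketSpan S k) (hG : G ∈ bracketSpan S m) : F * G ∈ bracketSpan S (k + m) := by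
  refine mul_mem_of_span ?_ hF hG
  rintro _ ⟨l, s, hs, hk, rfl⟩ _ ⟨l', t, ht, hm, rfl⟩
  exact bracketSpan_mono subset_rfl (by omega) (bracket_mul_mem hS hs ht)

theorem one_mem_bracketSpan (S : Set ℕ) (k : ℕ) : 1 ∈ bracketSpan S k := by
  rw [← bracket_nil Fin.elim0]
  exact bracket_mem_bracketSpan (fun i => i.elim0) (by simp)

/-- The span of all brackets with entries in a closed set of letters is a subalgebra. -/
theorem isSubalgebra_span {S : Set ℕ} (hS : ClosedLetters S) :
    IsSubalgebra (Submodule.span ℚ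
      {F | ∃ (l : ℕ) (s : Fin l → ℕ), (∀ i, s i ∈ S) ∧ F = bracket s}) := by
  have hle : ∀ k, bracketSpan S k ≤ Submodule.span ℚ
      {F | ∃ (l : ℕ) (s : Fin l → ℕ), (∀ i, s i ∈ S) ∧ F = bracket s} := fun k => by
    refine Submodule.span_mono ?_
    rintro f ⟨l, s, h1, h2, rfl⟩
    exact ⟨l, s, h1, rfl⟩
  refine ⟨hle 0 (one_mem_bracketSpan S 0), fun F hF G hG => ?_⟩
  refine mul_mem_of_span ?_ hF hG
  rintro _ ⟨l, s, hs, rfl⟩ _ ⟨m, t, ht, rfl⟩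
  exact hle _ (bracket_mul_mem hS hs ht)

theorem weightFil_le_MD (k : ℕ) : weightFil k ≤ MD := by
  refine Submodule.span_mono ?_
  rintro f ⟨l, s, h1, h2, rfl⟩
  exact ⟨l, s, h1, rfl⟩

theorem isSubalgebra_MD : IsSubalgebra MD :=
  isSubalgebra_span (S := {s | 0 < s}) closedLetters_pos

theorem isSubalgebra_MDSharp : IsSubalgebra MDSharp :=
  isSubalgebra_span (S := {s | 1 < s}) closedLetters_one_lt

theorem isSubalgebra_MDEven : IsSubalgebra MDEven :=
  isSubalgebra_span (S := {s | 0 < s ∧ Even s}) closedLetters_even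

theorem bracketSpan_even_le_MDEven (k : ℕ) : bracketSpan {s | 0 < s ∧ Even s} k ≤ MDEven := by
  refine Submodule.span_mono ?_
  rintro f ⟨l, s, h1, h2, rfl⟩
  exact ⟨l, s, h1, rfl⟩

theorem MDEven_le_MDSharp : MDEven ≤ MDSharp := by
  refine Submodule.span_mono ?_
  rintro f ⟨l, s, h1, rfl⟩
  refine ⟨l, s, fun i => ?_, rfl⟩
  obtain ⟨h2, c, hc⟩ := h1 i
  omega

theorem MDSharp_le_MDA : MDSharp ≤ MDA := by
  refine Submodule.span_mono ?_
  rintro f ⟨l, s, h1, rfl⟩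
  exact ⟨l, s, fun i => Nat.zero_lt_of_lt (h1 i), fun i _ => h1 i, rfl⟩

theorem MDA_le_MD : MDA ≤ MD := by
  refine Submodule.span_mono ?_
  rintro f ⟨l, s, h1, -, rfl⟩
  exact ⟨l, s, h1, rfl⟩

theorem wordSeq_cons_mem_MDA {j : ℕ} (hj : 1 < j) {w : List ℕ} (hw : ∀ s ∈ w, 0 < s) :
    wordSeq (j :: w) ∈ stabilizingTo MDA := by
  refine wordSeq_mem_stabilizingTo (Submodule.subset_span ⟨_, _, fun i => ?_, fun i hi => ?_, rfl⟩)
  · have := List.get_mem (j :: w) i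
    rcases List.mem_cons.1 this with h | h
    · rw [h]
      exact Nat.zero_lt_of_lt hj
    · exact hw _ h
  · have : i = ⟨0, by simp⟩ := Fin.ext hi
    subst this
    exact hj

theorem isSubalgebra_MDA : IsSubalgebra MDA := by
  refine ⟨?_, fun F hF G hG => ?_⟩
  · rw [← bracket_nil Fin.elim0]
    exact Submodule.subset_span ⟨0, _, fun i => i.elim0, fun i => i.elim0, rfl⟩
  · refine mul_mem_of_span ?_ hF hG
    rintro _ ⟨l, s, hs, hs1, rfl⟩ _ ⟨m, t, ht, ht1, rfl⟩
    cases l with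
    | zero =>
      rw [bracket_nil, one_mul]
      exact Submodule.subset_span ⟨m, t, ht, ht1, rfl⟩
    | succ l =>
      cases m with
      | zero =>
        rw [bracket_nil, mul_one]
        exact Submodule.subset_span ⟨_, s, hs, hs1, rfl⟩
      | succ m =>
        refine ((stabilizesTo_wordSeq s).mul (stabilizesTo_wordSeq t)).mem ?_
        have hs0 := hs1 0 rfl
        have ht0 := ht1 0 rfl
        have hs' : ∀ a ∈ List.ofFn s, 0 < a := List.forall_mem_ofFn_iff.2 hs
        have ht' : ∀ a ∈ List.ofFn t, 0 < a := List.forall_mem_ofFn_iff.2 ht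
        rw [List.ofFn_succ] at hs' ht' ⊢
        rw [List.ofFn_succ (f := t), wordSeq_cons_mul_cons]
        have hs'' := (List.forall_mem_cons.1 hs').2
        have ht'' := (List.forall_mem_cons.1 ht').2
        -- Admissibility concerns only the first letter, and in each of the three quasi-shuffle
        -- terms this is `s 0`, `t 0` or a combination of letters above 1; the tails may be
        -- arbitrary positive words.
        have key : ∀ {k m : ℕ} {g f : ℕ → ℚ⟦X⟧}, g ∈ letterSpan {s | 1 < s} m →
            f ∈ wordSpan {s | 0 < s} k → sumBelow (g * f) ∈ stabilizingTo MDA :=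
          fun hg hf => sumBelow_mul_mem (fun j hj _ w hw _ => wordSeq_cons_mem_MDA hj hw) hg hf
        refine Submodule.add_mem _ (Submodule.add_mem _ ?_ ?_) ?_
        · exact key (bracketLetter_mem_letterSpan hs0 le_rfl)
            (wordSeq_mul_mem closedLetters_pos _ _ hs'' ht')
        · exact key (bracketLetter_mem_letterSpan ht0 le_rfl)
            (wordSeq_mul_mem closedLetters_pos _ _ hs' ht'')
        · exact key (bracketLetter_mul_mem_one_lt hs0 (ht 0))
            (wordSeq_mul_mem closedLetters_pos _ _ hs'' ht'')

/-! ### Conjugation of partitions -/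

/-- Extension of `u : Fin l → ℕ` to `ℕ` by zero. -/
def extendZero {l : ℕ} (u : Fin l → ℕ) (k : ℕ) : ℕ := if h : k < l then u ⟨k, h⟩ else 0

theorem extendZero_val {l : ℕ} (u : Fin l → ℕ) (i : Fin l) : extendZero u i = u i := by
  simp [extendZero]

theorem extendZero_of_lt {l k : ℕ} (u : Fin l → ℕ) (h : k < l) : extendZero u k = u ⟨k, h⟩ := by
  simp [extendZero, h]

/-- This boundary value makes the smallest part, minus zero, the first multiplicity of the conjugate
partition. -/
theorem extendZero_self {l : ℕ} (u : Fin l → ℕ) : extendZero u l = 0 := by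
  simp [extendZero]

/-- The conjugation of partitions, in terms of parts `u` and multiplicities `v`. -/
def conjPair {l : ℕ} (p : (Fin l → ℕ) × (Fin l → ℕ)) : (Fin l → ℕ) × (Fin l → ℕ) :=
  (fun i => ∑ k ∈ Finset.range (l - i), extendZero p.2 k,
    fun i => extendZero p.1 (l - 1 - i) - extendZero p.1 (l - i))

theorem extendZero_succ_lt {l : ℕ} {u : Fin l → ℕ} (hpos : ∀ i, 0 < u i)
    (hdec : ∀ i j : Fin l, i < j → u j < u i) {k : ℕ} (hk : k < l) :
    extendZero u (k + 1) < extendZero u k := by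
  rw [extendZero_of_lt u hk]
  by_cases h : k + 1 < l
  · rw [extendZero_of_lt u h]
    exact hdec _ _ (by simp)
  · simp [extendZero, h, hpos]

theorem extendZero_succ_le {l : ℕ} {u : Fin l → ℕ} (hpos : ∀ i, 0 < u i)
    (hdec : ∀ i j : Fin l, i < j → u j < u i) (k : ℕ) :
    extendZero u (k + 1) ≤ extendZero u k := by
  by_cases hk : k < l
  · exact (extendZero_succ_lt hpos hdec hk).le
  · simp [extendZero, show ¬ k + 1 < l by omega]

/-- Abel summation in a subtraction-safe form; with `U m = 0` it says that conjugation preserves the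
size of a partition. -/
theorem sum_range_mul_sub (U V : ℕ → ℕ) (hU : ∀ k, U (k + 1) ≤ U k) (m : ℕ) :
    ∑ k ∈ Finset.range m, (∑ j ∈ Finset.range (k + 1), V j) * (U k - U (k + 1)) +
      (∑ j ∈ Finset.range m, V j) * U m = ∑ k ∈ Finset.range m, U k * V k := by
  induction m with
  | zero => simp
  | succ m ih =>
    rw [Finset.sum_range_succ, Finset.sum_range_succ (fun k => U k * V k), ← ih, add_assoc,
      ← mul_add, Nat.sub_add_cancel (hU m), Finset.sum_range_succ]
    ring

theorem sum_conjPair {l : ℕ} {p : (Fin l → ℕ) × (Fin l → ℕ)} (hpos : ∀ i, 0 < p.1 i)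
    (hdec : ∀ i j : Fin l, i < j → p.1 j < p.1 i) :
    ∑ i, (conjPair p).1 i * (conjPair p).2 i = ∑ i, p.1 i * p.2 i := by
  have h := sum_range_mul_sub (extendZero p.1) (extendZero p.2) (extendZero_succ_le hpos hdec) l
  rw [extendZero_self, mul_zero, add_zero, Finset.sum_range, Finset.sum_range] at h
  simp only [extendZero_val] at h
  rw [← h, ← Equiv.sum_comp Fin.revPerm]
  refine Finset.sum_congr rfl fun i _ => ?_
  have h1 : l - (i.rev : ℕ) = i + 1 := by
    rw [Fin.val_rev]
    omega
  have h2 : l - 1 - (i.rev : ℕ) = i := by omega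
  simp only [conjPair, Fin.revPerm_apply, h1, h2, extendZero_val]

theorem conjPair_mem {l n : ℕ} {p : (Fin l → ℕ) × (Fin l → ℕ)} (hp : p ∈ divisorPairs l n) :
    conjPair p ∈ divisorPairs l n := by
  rw [mem_divisorPairs] at hp ⊢
  obtain ⟨h1, h2, h3, h4⟩ := hp
  have hV : ∀ k < l, 0 < extendZero p.2 k := fun k hk => by
    rw [extendZero_of_lt _ hk]
    exact h2 _
  refine ⟨fun i => ?_, fun i => ?_, fun i j hij => ?_, (sum_conjPair h1 h3).trans h4⟩
  · change 0 < ∑ k ∈ Finset.range (l - i), extendZero p.2 k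
    refine Finset.sum_pos (fun k hk => hV k ?_) ⟨0, ?_⟩
    · rw [Finset.mem_range] at hk
      omega
    · rw [Finset.mem_range]
      omega
  · refine Nat.sub_pos_of_lt ?_
    have := extendZero_succ_lt h1 h3 (show l - 1 - (i : ℕ) < l by omega)
    rwa [show l - 1 - (i : ℕ) + 1 = l - i by omega] at this
  · have hij' : (i : ℕ) < j := hij
    change ∑ k ∈ Finset.range (l - j), extendZero p.2 k <
      ∑ k ∈ Finset.range (l - i), extendZero p.2 k
    refine Finset.sum_lt_sum_of_subset (i := l - (j : ℕ)) ?_ ?_ ?_ (hV _ ?_)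
      fun _ _ _ => Nat.zero_le _
    · exact Finset.range_subset_range.2 (by omega)
    · rw [Finset.mem_range]
      omega
    · simp
    · omega

theorem conjPair_conjPair {l n : ℕ} {p : (Fin l → ℕ) × (Fin l → ℕ)}
    (hp : p ∈ divisorPairs l n) : conjPair (conjPair p) = p := by
  rw [mem_divisorPairs] at hp
  obtain ⟨h1, h2, h3, h4⟩ := hp
  ext i
  -- Partial sums of the new multiplicities telescope to the original parts.
  · have key : ∀ t ≤ l, ∑ k ∈ Finset.range t, extendZero (conjPair p).2 k =
        extendZero p.1 (l - t) := by
      intro t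
      induction t with
      | zero => simp [extendZero_self]
      | succ t ih =>
        intro ht
        rw [Finset.sum_range_succ, ih (by omega), extendZero_of_lt _ (show t < l by omega)]
        have := extendZero_succ_le h1 h3 (l - (t + 1))
        rw [show l - (t + 1) + 1 = l - t by omega] at this
        simp only [conjPair]
        rw [show l - 1 - t = l - (t + 1) by omega]
        omega
    change ∑ k ∈ Finset.range (l - i), extendZero (conjPair p).2 k = p.1 i
    rw [key _ (by omega), show l - (l - (i : ℕ)) = i by omega, extendZero_val]
  -- Conversely, consecutive differences of the partial sums return the original multiplicities.
  · have key : ∀ k ≤ l, extendZero (conjPair p).1 k =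
        ∑ j ∈ Finset.range (l - k), extendZero p.2 j := by
      intro k hk
      rcases hk.eq_or_lt with rfl | hk
      · simp [extendZero_self]
      · rw [extendZero_of_lt _ hk]
        rfl
    change extendZero (conjPair p).1 (l - 1 - i) - extendZero (conjPair p).1 (l - i) = p.2 i
    rw [key _ (by omega), key _ (by omega), show l - (l - 1 - (i : ℕ)) = i + 1 by omega,
      show l - (l - (i : ℕ)) = i by omega, Finset.sum_range_succ, Nat.add_sub_cancel_left,
      extendZero_val]

/-- The generating series of the sums of `F` over the pairs counted by multiple divisor sums. -/
noncomputable def pairSeries (l : ℕ) : ((Fin l → ℕ) × (Fin l → ℕ) → ℚ) →ₗ[ℚ] ℚ⟦X⟧ where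
  toFun F := PowerSeries.mk fun n => ∑ p ∈ divisorPairs l n, F p
  map_add' F G := by
    ext n
    simp [Finset.sum_add_distrib]
  map_smul' c F := by
    ext n
    simp [Finset.mul_sum]

theorem pairSeries_congr {l : ℕ} {F G : (Fin l → ℕ) × (Fin l → ℕ) → ℚ}
    (h : ∀ n, ∀ p ∈ divisorPairs l n, F p = G p) : pairSeries l F = pairSeries l G := by
  ext n
  simp only [pairSeries, LinearMap.coe_mk, AddHom.coe_mk, PowerSeries.coeff_mk]
  exact Finset.sum_congr rfl (h n)

theorem pairSeries_comp_conjPair {l : ℕ} (F : (Fin l → ℕ) × (Fin l → ℕ) → ℚ) :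
    pairSeries l (fun p => F (conjPair p)) = pairSeries l F := by
  ext n
  simp only [pairSeries, LinearMap.coe_mk, AddHom.coe_mk, PowerSeries.coeff_mk]
  exact Finset.sum_nbij' conjPair conjPair (fun p hp => conjPair_mem hp)
    (fun p hp => conjPair_mem hp) (fun p hp => conjPair_conjPair hp)
    (fun p hp => conjPair_conjPair hp) (fun p _ => rfl)

/-- The polynomial functions of degree at most `k` on `ℕ ^ l`. -/
noncomputable def polyFun (l k : ℕ) : Submodule ℚ ((Fin l → ℕ) → ℚ) :=
  Submodule.span ℚ {f | ∃ e : Fin l → ℕ, ∑ i, e i ≤ k ∧ f = fun x => ∏ i, (x i : ℚ) ^ e i}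

theorem monomial_mem_polyFun {l k : ℕ} {e : Fin l → ℕ} (he : ∑ i, e i ≤ k) :
    (fun x : Fin l → ℕ => ∏ i, (x i : ℚ) ^ e i) ∈ polyFun l k :=
  Submodule.subset_span ⟨e, he, rfl⟩

theorem polyFun_mul_mem {l a b : ℕ} {f g : (Fin l → ℕ) → ℚ} (hf : f ∈ polyFun l a)
    (hg : g ∈ polyFun l b) : f * g ∈ polyFun l (a + b) := by
  refine mul_mem_of_span ?_ hf hg
  rintro _ ⟨e, he, rfl⟩ _ ⟨e', he', rfl⟩
  have : (fun x : Fin l → ℕ => ∏ i, (x i : ℚ) ^ e i) * (fun x => ∏ i, (x i : ℚ) ^ e' i) =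
      fun x => ∏ i, (x i : ℚ) ^ (e + e') i := by
    ext x
    simp [pow_add, Finset.prod_mul_distrib]
  rw [this]
  refine monomial_mem_polyFun ?_
  simp only [Pi.add_apply, Finset.sum_add_distrib]
  omega

theorem one_mem_polyFun (l : ℕ) : (1 : (Fin l → ℕ) → ℚ) ∈ polyFun l 0 := by
  have := monomial_mem_polyFun (l := l) (k := 0) (e := 0) (by simp)
  convert this using 1
  ext x
  simp

theorem polyFun_pow_mem {l a : ℕ} {f : (Fin l → ℕ) → ℚ} (hf : f ∈ polyFun l a) (n : ℕ) :
    f ^ n ∈ polyFun l (n * a) := by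
  induction n with
  | zero => simpa using one_mem_polyFun l
  | succ n ih =>
    rw [pow_succ, add_mul, one_mul]
    exact polyFun_mul_mem ih hf

theorem prod_pow_mem_polyFun {l m : ℕ} {g : Fin m → (Fin l → ℕ) → ℚ}
    (hg : ∀ i, g i ∈ polyFun l 1) (e : Fin m → ℕ) :
    ∏ i, g i ^ e i ∈ polyFun l (∑ i, e i) := by
  have : ∀ s : Finset (Fin m), ∏ i ∈ s, g i ^ e i ∈ polyFun l (∑ i ∈ s, e i) := by
    intro s
    induction s using Finset.induction_on with
    | empty => simpa using one_mem_polyFun l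
    | insert i s hi ih =>
      rw [Finset.prod_insert hi, Finset.sum_insert hi]
      have := polyFun_pow_mem (hg i) (e i)
      rw [mul_one] at this
      exact polyFun_mul_mem this ih
  exact this _

theorem extendZero_mem_polyFun (l k : ℕ) :
    (fun x : Fin l → ℕ => (extendZero x k : ℚ)) ∈ polyFun l 1 := by
  by_cases h : k < l
  · have := monomial_mem_polyFun (l := l) (k := 1) (e := Pi.single ⟨k, h⟩ 1) (by simp)
    convert this using 2 with x
    rw [extendZero_of_lt _ h, Finset.prod_eq_single ⟨k, h⟩]
    · simp
    · intro i _ hi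
      simp [hi]
    · simp
  · simp only [extendZero, h, dite_false, Nat.cast_zero]
    exact Submodule.zero_mem _

/-- A monomial in `v` with exponents `e` gives a multiple of the bracket with entries `e i + 1`,
whence the extra `l` in the weight. -/
theorem pairSeries_snd_mem {l k : ℕ} {f : (Fin l → ℕ) → ℚ} (hf : f ∈ polyFun l k) :
    pairSeries l (fun p => f p.2) ∈ weightFil (k + l) := by
  suffices polyFun l k ≤ (weightFil (k + l)).comap
      ((pairSeries l).comp (LinearMap.funLeft ℚ ℚ Prod.snd)) from this hf
  refine Submodule.span_le.2 ?_
  rintro _ ⟨e, he, rfl⟩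
  have : pairSeries l (fun p => ∏ i, (p.2 i : ℚ) ^ e i) =
      (∏ i, ((e i).factorial : ℚ)) • bracket (fun i => e i + 1) := by
    ext n
    have h : (∏ i, ((e i).factorial : ℚ)) ≠ 0 :=
      Finset.prod_ne_zero_iff.2 fun i _ => by positivity
    simp only [pairSeries, LinearMap.coe_mk, AddHom.coe_mk, PowerSeries.coeff_mk, bracket,
      multipleDivisorSum, map_smul, smul_eq_mul, Nat.add_sub_cancel]
    rw [mul_div_cancel₀ _ h]
    push_cast
    rfl
  change pairSeries l (fun p => ∏ i, (p.2 i : ℚ) ^ e i) ∈ weightFil (k + l)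
  rw [this]
  refine Submodule.smul_mem _ _ (Submodule.subset_span ⟨l, _, fun i => Nat.succ_pos _, ?_, rfl⟩)
  rw [show ∑ i, (e i).succ = ∑ i, (e i + 1) from rfl, Finset.sum_add_distrib]
  simpa using he

/-- After conjugation each `u i` becomes a partial sum of the `v`, hence linear, so the degree and
with it the weight do not grow. -/
theorem pairSeries_monomial_fst_mem {l : ℕ} (e : Fin l → ℕ) :
    pairSeries l (fun p => ∏ i, (p.1 i : ℚ) ^ e i) ∈ weightFil (∑ i, e i + l) := by
  rw [← pairSeries_comp_conjPair]
  have h := prod_pow_mem_polyFun (l := l)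
    (g := fun (i : Fin l) x => ∑ k ∈ Finset.range (l - i), (extendZero x k : ℚ)) (fun i => ?_) e
  · have := pairSeries_snd_mem h
    simpa [conjPair] using this
  · have := Submodule.sum_mem (polyFun l 1) (t := Finset.range (l - i))
      fun k _ => extendZero_mem_polyFun l k
    convert this using 1
    ext x
    simp

theorem pairSeries_monomial_snd_mem {l : ℕ} (e : Fin l → ℕ) :
    ∃ f ∈ polyFun l (∑ i, e i),
      pairSeries l (fun p => ∏ i, (p.2 i : ℚ) ^ e i) = pairSeries l (fun p => f p.1) := by
  refine ⟨_, prod_pow_mem_polyFun (l := l) (g := fun (i : Fin l) x =>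
    (extendZero x (l - 1 - i) : ℚ) - (extendZero x (l - i) : ℚ)) (fun i =>
    Submodule.sub_mem _ (extendZero_mem_polyFun _ _) (extendZero_mem_polyFun _ _)) e, ?_⟩
  rw [← pairSeries_comp_conjPair]
  refine pairSeries_congr fun n p hp => ?_
  rw [mem_divisorPairs] at hp
  simp only [conjPair, Finset.prod_apply, Pi.pow_apply]
  refine Finset.prod_congr rfl fun i _ => ?_
  -- The truncated difference is a true difference, since the parts decrease.
  rw [Nat.cast_sub]
  have := extendZero_succ_le hp.1 hp.2.2.1 (l - 1 - i)
  rwa [show l - 1 - (i : ℕ) + 1 = l - i by omega] at this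

/-! ### The derivation on brackets -/

/-- The sequence of the series `∑_{v > 0} u^e q^{uv}`, where `u = a + 1`. -/
noncomputable def dualLetter (e : ℕ) : ℕ → ℚ⟦X⟧ := letter fun u _ => (u : ℚ) ^ e

theorem dualLetter_apply (e a : ℕ) :
    dualLetter e a = ((a : ℚ) + 1) ^ e • bracketLetter 1 a := by
  ext n
  simp [dualLetter, bracketLetter, letter]

theorem d_smul (c : ℚ) (F : ℚ⟦X⟧) : d (c • F) = c • d F := d.map_smul c F

/-- Here `d = u D` and `D L_1 = L_1 + L_1²`. The quadratic term is the one that a quasi-shuffle with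
the letter `u L_1` produces. -/
theorem d_dualLetter (e a : ℕ) :
    d (dualLetter e a) = dualLetter (e + 1) a + dualLetter 1 a * dualLetter e a := by
  have h := scaledD_bracketLetter 0
  simp only [zero_add, Nat.cast_zero, one_smul] at h
  have h1 := congrFun (h.trans bracketLetter_two) a
  have h0 : (a : ℚ) + 1 ≠ 0 := by positivity
  rw [scaledD_apply, inv_smul_eq_iff₀ h0] at h1
  simp only [dualLetter_apply, d_smul, h1, Pi.add_apply, Pi.pow_apply, smul_add, smul_mul_smul,
    smul_smul]
  rw [sq, ← pow_succ, pow_one, ← pow_succ']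

/-- The truncations of the sums `∑ u^e q^{uv}`. -/
noncomputable def dualSeq (w : List ℕ) : ℕ → ℚ⟦X⟧ := nested (w.map dualLetter)

theorem dualSeq_cons (e : ℕ) (w : List ℕ) :
    dualSeq (e :: w) = sumBelow (dualLetter e * dualSeq w) := rfl

theorem stabilizesTo_dualSeq {l : ℕ} (e : Fin l → ℕ) :
    StabilizesTo (dualSeq (List.ofFn e)) (pairSeries l fun p => ∏ i, (p.1 i : ℚ) ^ e i) := by
  have h := stabilizesTo_nested_letter fun (i : Fin l) (u _ : ℕ) => (u : ℚ) ^ e i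
  rw [dualSeq, List.map_ofFn]
  exact h

/-- The span of the truncated dual sums of weight at most `k`. -/
noncomputable def dualSpan (k : ℕ) : Submodule ℚ (ℕ → ℚ⟦X⟧) :=
  Submodule.span ℚ {f | ∃ w : List ℕ, w.sum + w.length ≤ k ∧ f = dualSeq w}

theorem dualSeq_mem_dualSpan {w : List ℕ} {k : ℕ} (h : w.sum + w.length ≤ k) :
    dualSeq w ∈ dualSpan k := Submodule.subset_span ⟨w, h, rfl⟩

/-- Only the limits are compared with brackets: conjugation does not respect the truncation by the
largest part. -/
theorem dualSpan_le_stabilizingTo (k : ℕ) : dualSpan k ≤ stabilizingTo (weightFil k) := by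
  refine Submodule.span_le.2 ?_
  rintro _ ⟨w, hw, rfl⟩
  have h := stabilizesTo_dualSeq fun i : Fin w.length => w.get i
  rw [List.ofFn_get] at h
  refine ⟨_, ?_, h⟩
  have h2 := pairSeries_monomial_fst_mem fun i : Fin w.length => w.get i
  rw [← List.sum_ofFn, List.ofFn_get] at h2
  -- `weightFil k` unfolds to `bracketSpan {s | 0 < s} k`.
  exact bracketSpan_mono subset_rfl hw h2

theorem sumBelow_dualLetter_mul_mem {e k : ℕ} {f : ℕ → ℚ⟦X⟧} (hf : f ∈ dualSpan k) :
    sumBelow (dualLetter e * f) ∈ dualSpan (k + e + 1) := by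
  suffices dualSpan k ≤ (dualSpan (k + e + 1)).comap
      (sumBelow.comp (LinearMap.mulLeft ℚ (dualLetter e))) from this hf
  refine Submodule.span_le.2 ?_
  rintro _ ⟨w, hw, rfl⟩
  refine Submodule.subset_span ⟨e :: w, ?_, rfl⟩
  simp only [List.sum_cons, List.length_cons]
  omega

theorem dualSpan_mono {k m : ℕ} (h : k ≤ m) : dualSpan k ≤ dualSpan m := by
  refine Submodule.span_mono ?_
  rintro f ⟨w, h1, rfl⟩
  exact ⟨w, h1.trans h, rfl⟩

/-- The product with `dualSeq [1]` contains every term in which the letter 1 is merged into a letter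
of `w`, and these cancel the quadratic terms of `d`. What remains is the words with one exponent
raised, minus the words with a letter 1 inserted; the weight grows by at most 2. -/
theorem d_dualSeq_sub_mem (w : List ℕ) :
    (fun N => d (dualSeq w N)) - dualSeq [1] * dualSeq w ∈
      dualSpan (w.sum + w.length + 2) := by
  induction w with
  | nil =>
    have h1 : (fun N => d (dualSeq [] N)) = 0 := by
      ext1 N
      simp [dualSeq, nested]
    have h2 : dualSeq [] = 1 := rfl
    rw [h1, h2, mul_one, zero_sub]
    exact Submodule.neg_mem _ (dualSeq_mem_dualSpan (by simp))
  | cons e w ih =>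
    set D : ℕ → ℚ⟦X⟧ := fun N => d (dualSeq w N) with hD
    have h1 : (fun N => d (dualSeq (e :: w) N)) =
        sumBelow ((dualLetter (e + 1) + dualLetter 1 * dualLetter e) * dualSeq w +
          dualLetter e * D) := by
      refine eq_sumBelow_iff (by simp [dualSeq_cons, sumBelow_zero]) fun N => ?_
      rw [dualSeq_cons, sumBelow_succ, map_add]
      congr 1
      simp only [Pi.mul_apply, Derivation.leibniz, d_dualLetter, Pi.add_apply, smul_eq_mul, hD]
      ring
    have h2 : dualSeq [1] * dualSeq (e :: w) = sumBelow (dualLetter 1 * dualSeq (e :: w) +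
        dualSeq [1] * (dualLetter e * dualSeq w) + dualLetter 1 * (dualLetter e * dualSeq w)) := by
      have h3 : dualSeq [1] = sumBelow (dualLetter 1) := by
        rw [dualSeq_cons]
        exact congrArg sumBelow (mul_one _)
      rw [h3, dualSeq_cons, sumBelow_mul_sumBelow]
    have h3 : (fun N => d (dualSeq (e :: w) N)) - dualSeq [1] * dualSeq (e :: w) =
        dualSeq ((e + 1) :: w) + sumBelow (dualLetter e * (D - dualSeq [1] * dualSeq w)) -
          dualSeq (1 :: e :: w) := by
      rw [h1, h2, dualSeq_cons (e + 1), dualSeq_cons 1 (e :: w), ← map_add, ← map_sub, ← map_sub]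
      congr 1
      ring
    rw [h3]
    refine Submodule.sub_mem _ (Submodule.add_mem _ (dualSeq_mem_dualSpan ?_)
      (dualSpan_mono ?_ (sumBelow_dualLetter_mul_mem ih))) (dualSeq_mem_dualSpan ?_) <;>
    simp only [List.sum_cons, List.length_cons] <;> omega

/-- Conjugation reduces a bracket to sums weighted by monomials in `u`. For these, `d` is
multiplication by `∑ u q^{uv}`, which lies in `weightFil 2`, up to an error of weight `k + 2`. -/
theorem d_mem_weightFil {k : ℕ} {F : ℚ⟦X⟧} (hF : F ∈ weightFil k) : d F ∈ weightFil (k + 2) := by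
  have hfst : ∀ {l : ℕ} (e : Fin l → ℕ), ∑ i, e i + l ≤ k →
      d (pairSeries l fun p => ∏ i, (p.1 i : ℚ) ^ e i) ∈ weightFil (k + 2) := by
    intro l e he
    have hs := stabilizesTo_dualSeq e
    have hone : dualSeq [1] ∈ dualSpan 2 := dualSeq_mem_dualSpan (by simp)
    obtain ⟨G, hG, hG'⟩ := dualSpan_le_stabilizingTo _ hone
    have h1 := (hs.derivation.sub (hG'.mul hs)).mem
      (dualSpan_le_stabilizingTo _ (d_dualSeq_sub_mem (List.ofFn e)))
    rw [List.sum_ofFn, List.length_ofFn] at h1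
    have h2 : G * (pairSeries l fun p => ∏ i, (p.1 i : ℚ) ^ e i) ∈ weightFil (2 + k) :=
      bracketSpan_mul_mem closedLetters_pos hG
        (bracketSpan_mono subset_rfl he (pairSeries_monomial_fst_mem e))
    rw [add_comm] at h2
    have := Submodule.add_mem _ (bracketSpan_mono subset_rfl (by omega) h1) h2
    rwa [sub_add_cancel] at this
  suffices weightFil k ≤ (weightFil (k + 2)).comap d.toLinearMap from this hF
  refine Submodule.span_le.2 ?_
  rintro _ ⟨l, s, hs, hk, rfl⟩
  obtain ⟨f, hf, hfs⟩ := pairSeries_monomial_snd_mem fun i => s i - 1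
  have hb : bracket s = (∏ i, ((s i - 1).factorial : ℚ))⁻¹ •
      pairSeries l fun p => ∏ i, (p.2 i : ℚ) ^ (s i - 1) := by
    ext n
    simp only [pairSeries, LinearMap.coe_mk, AddHom.coe_mk, PowerSeries.coeff_mk, bracket,
      multipleDivisorSum, map_smul, smul_eq_mul]
    rw [div_eq_inv_mul]
    push_cast
    rfl
  change d (bracket s) ∈ weightFil (k + 2)
  rw [hb, d_smul, hfs]
  refine Submodule.smul_mem _ _ ?_
  suffices polyFun l (∑ i, (s i - 1)) ≤ (weightFil (k + 2)).comap (d.toLinearMap.comp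
      ((pairSeries l).comp (LinearMap.funLeft ℚ ℚ Prod.fst))) from this hf
  refine Submodule.span_le.2 ?_
  rintro _ ⟨e, he, rfl⟩
  refine hfst e ?_
  have : ∑ i, s i = ∑ i, (s i - 1) + l := by
    have h : ∑ i, s i = ∑ i, ((s i - 1) + 1) :=
      Finset.sum_congr rfl fun i _ => (Nat.sub_add_cancel (hs i)).symm
    rw [h, Finset.sum_add_distrib]
    simp
  omega

theorem d_mem_MD {F : ℚ⟦X⟧} (hF : F ∈ MD) : d F ∈ MD := by
  suffices MD ≤ MD.comap d.toLinearMap from this hF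
  refine Submodule.span_le.2 ?_
  rintro _ ⟨l, s, hs, rfl⟩
  exact weightFil_le_MD _ (d_mem_weightFil (bracket_mem_bracketSpan hs le_rfl))

/-! ### Fourier expansions and Eisenstein series -/

open UpperHalfPlane hiding I
open Complex ModularForm EisensteinSeries Derivative
open scoped Real Topology

/-- The power series `F` with complex coefficients is the Fourier expansion of `f`. -/
def HasFourier (F : ℂ⟦X⟧) (f : ℍ → ℂ) : Prop :=
  ∀ τ : ℍ, HasSum (fun n : ℕ => PowerSeries.coeff n F * cexp (2 * π * Complex.I * (τ : ℂ)) ^ n)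
    (f τ)

/-- The complexification of a power series with rational coefficients. -/
noncomputable abbrev complexify : ℚ⟦X⟧ →+* ℂ⟦X⟧ := PowerSeries.map (algebraMap ℚ ℂ)

theorem complexify_injective : Function.Injective complexify :=
  PowerSeries.map_injective _ (algebraMap ℚ ℂ).injective

theorem isFourierExpansion_iff {F : ℚ⟦X⟧} {f : ℍ → ℂ} :
    IsFourierExpansion F f ↔ HasFourier (complexify F) f := by
  simp [IsFourierExpansion, HasFourier]

theorem complexify_smul (c : ℚ) (F : ℚ⟦X⟧) : complexify (c • F) = (c : ℂ) • complexify F := by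
  ext n
  simp

theorem qParam_one (τ : ℂ) : Function.Periodic.qParam 1 τ = cexp (2 * π * Complex.I * τ) := by
  simp [Function.Periodic.qParam]

theorem HasFourier.of_modularForm {k : ℤ} (f : ModularForm 𝒮ℒ k) : HasFourier (qExpansion 1 f) f := by
  intro τ
  have := ModularForm.hasSum_qExpansion f one_pos one_mem_strictPeriods_SL τ
  simpa only [ofReal_one, qParam_one] using this

namespace HasFourier

theorem eq_qExpansion {F : ℂ⟦X⟧} {k : ℤ} {f : ModularForm 𝒮ℒ k} (h : HasFourier F f) :
    F = qExpansion 1 f := by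
  ext n
  refine ModularFormClass.qExpansion_coeff_unique one_pos one_mem_strictPeriods_SL (f := f)
    (c := fun m => PowerSeries.coeff m F) (fun τ => ?_) n
  simpa only [qParam_one, smul_eq_mul] using h τ

theorem zero : HasFourier 0 0 := fun τ => by simp [hasSum_zero]

theorem one : HasFourier 1 1 := fun τ => by
  convert! hasSum_ite_eq 0 (1 : ℂ) using 2 with n
  by_cases hn : n = 0 <;> simp [PowerSeries.coeff_one, hn]

theorem add {F G : ℂ⟦X⟧} {f g : ℍ → ℂ} (hF : HasFourier F f) (hG : HasFourier G g) :
    HasFourier (F + G) (f + g) := fun τ => by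
  simpa [add_mul] using (hF τ).add (hG τ)

theorem smul {F : ℂ⟦X⟧} {f : ℍ → ℂ} (c : ℂ) (hF : HasFourier F f) :
    HasFourier (c • F) (c • f) := fun τ => by
  simpa [mul_assoc] using (hF τ).mul_left c

theorem sub {F G : ℂ⟦X⟧} {f g : ℍ → ℂ} (hF : HasFourier F f) (hG : HasFourier G g) :
    HasFourier (F - G) (f - g) := fun τ => by
  simpa [sub_mul] using (hF τ).sub (hG τ)

theorem mul {F G : ℂ⟦X⟧} {f g : ℍ → ℂ} (hF : HasFourier F f) (hG : HasFourier G g) :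
    HasFourier (F * G) (f * g) := fun τ => by
  have h := summable_norm_sum_mul_antidiagonal_of_summable_norm (hF τ).summable.norm
    (hG τ).summable.norm
  have h1 := tsum_mul_tsum_eq_tsum_sum_antidiagonal_of_summable_norm (hF τ).summable.norm
    (hG τ).summable.norm
  have h2 := h.of_norm.hasSum
  rw [← h1, (hF τ).tsum_eq, (hG τ).tsum_eq] at h2
  convert! h2 using 2 with n
  rw [PowerSeries.coeff_mul, Finset.sum_mul]
  refine Finset.sum_congr rfl fun p hp => ?_
  rw [← Finset.HasAntidiagonal.mem_antidiagonal.1 hp, pow_add]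
  ring

/-- No modularity of `f` is needed: the difference expands the zero function, which is a modular
form of weight 0. -/
theorem unique {F G : ℂ⟦X⟧} {f : ℍ → ℂ} (hF : HasFourier F f) (hG : HasFourier G f) : F = G := by
  have h := hF.sub hG
  rw [sub_self] at h
  have h1 := eq_qExpansion (k := 0) (f := 0) h
  have h2 := eq_qExpansion (k := 0) (f := 0) HasFourier.zero
  exact sub_eq_zero.1 (h1.trans h2.symm)

theorem eq_of_eq {F : ℂ⟦X⟧} {f g : ℍ → ℂ} (hf : HasFourier F f) (hg : HasFourier F g) : f = g := by
  ext τ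
  exact (hf τ).unique (hg τ)

theorem isBoundedAtImInfty {F : ℂ⟦X⟧} {f : ℍ → ℂ} (hF : HasFourier F f) :
    IsBoundedAtImInfty f :=
  isBoundedAtImInfty_of_hasSum_qExpansion one_pos fun τ => by
    simpa only [qParam_one, smul_eq_mul] using hF τ

/-- Termwise differentiation of Fourier expansions. -/
theorem normalizedDeriv {F : ℂ⟦X⟧} {f : ℍ → ℂ} (hF : HasFourier F f) :
    HasFourier (PowerSeries.mk fun n => n * PowerSeries.coeff n F) (D f) := by
  intro τ
  have hy : 0 < τ.im / 2 := half_pos τ.im_pos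
  set U : Set ℂ := {w | τ.im / 2 < w.im} with hU
  have hUo : IsOpen U := isOpen_lt continuous_const continuous_im
  have hτ : (τ : ℂ) ∈ U := half_lt_self τ.im_pos
  -- The expansion converges absolutely at half the height of `τ`, and its terms there dominate
  -- those at every point of `U`.
  set τ₀ : ℍ := ⟨(τ.im / 2 : ℝ) * Complex.I, by simpa using hy⟩ with hτ₀
  have hu := (hF τ₀).summable.norm
  have hderiv : ∀ (n : ℕ) (w : ℂ), HasDerivAt
      (fun w => PowerSeries.coeff n F * cexp (2 * π * Complex.I * w) ^ n)
      (PowerSeries.coeff n F * (n * (2 * π * Complex.I) * cexp (2 * π * Complex.I * w) ^ n)) w := by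
    intro n w
    simp only [← Complex.exp_nat_mul]
    have h1 : HasDerivAt (fun w : ℂ => (n : ℂ) * (2 * π * Complex.I * w))
        (n * (2 * π * Complex.I)) w := by
      simpa using ((hasDerivAt_id w).const_mul (2 * π * Complex.I)).const_mul (n : ℂ)
    convert! (h1.cexp).const_mul (PowerSeries.coeff n F) using 1
    ring
  have key := hasSum_deriv_of_summable_norm hu (U := U)
    (F := fun n w => PowerSeries.coeff n F * cexp (2 * π * Complex.I * w) ^ n)
    (fun n w _ => (hderiv n w).differentiableAt.differentiableWithinAt) hUo (fun n w hw => ?_) hτ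
  · have h1 : deriv (fun w => ∑' n, PowerSeries.coeff n F * cexp (2 * π * Complex.I * w) ^ n) τ =
        deriv (f ∘ ofComplex) τ := by
      refine Filter.EventuallyEq.deriv_eq ?_
      filter_upwards [hUo.mem_nhds hτ] with w hw
      have hw0 : 0 < w.im := hy.trans hw
      rw [Function.comp_apply, ofComplex_apply_of_im_pos hw0]
      exact (hF ⟨w, hw0⟩).tsum_eq
    rw [h1] at key
    have h2 := key.mul_left ((2 * π * Complex.I)⁻¹)
    convert! h2 using 2 with n
    rw [(hderiv n τ).deriv, PowerSeries.coeff_mk]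
    have : (2 * π * Complex.I : ℂ) ≠ 0 := two_pi_I_ne_zero
    field_simp
  · rw [norm_mul, norm_mul, norm_pow, norm_pow]
    gcongr
    rw [Complex.norm_exp, Complex.norm_exp, Real.exp_le_exp]
    have hw' : τ.im / 2 < w.im := hw
    have : (τ₀ : ℂ) = (τ.im / 2 : ℝ) * Complex.I := rfl
    rw [this]
    simp only [mul_re, mul_im, re_ofNat, im_ofNat, ofReal_re, ofReal_im, Complex.I_re, Complex.I_im]
    nlinarith [Real.pi_pos]

end HasFourier

theorem hasFourier_d {F : ℚ⟦X⟧} {f : ℍ → ℂ} (hF : HasFourier (complexify F) f) :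
    HasFourier (complexify (d F)) (D f) := by
  convert! hF.normalizedDeriv using 1
  ext n
  simp [coeff_d]

theorem coeff_bracket_singleton (k n : ℕ) :
    PowerSeries.coeff n (bracket ![k]) =
      (ArithmeticFunction.sigma (k - 1) n : ℚ) / ((k - 1).factorial : ℚ) := by
  have h := stabilizesTo_wordSeq ![k] n n le_rfl
  have h1 : wordSeq (List.ofFn ![k]) = sumBelow (bracketLetter k) := by
    have : List.ofFn ![k] = [k] := by simp
    rw [this, wordSeq_cons, wordSeq_nil, mul_one]
  rw [← h, h1, sumBelow_apply, map_sum]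
  simp only [bracketLetter, letter, PowerSeries.coeff_mk]
  rcases Nat.eq_zero_or_pos n with rfl | hn
  · simp
  -- The letters are indexed by the divisor `u` but weighted by `v = n / u`, so the divisor sum is
  -- reindexed by the complementary divisor.
  rw [ArithmeticFunction.sigma_apply, ← Nat.sum_div_divisors, Nat.cast_sum, Finset.sum_div,
    Nat.divisors, Finset.sum_filter, Finset.sum_Ico_eq_sum_range]
  simp only [Nat.add_sub_cancel, hn.ne', ne_eq, not_false_eq_true, and_true, add_comm 1]
  refine Finset.sum_congr rfl fun a _ => ?_
  push_cast
  rfl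

theorem coeff_eisensteinG (k n : ℕ) :
    PowerSeries.coeff n (eisensteinG k) = if n = 0 then -(bernoulli k) / (2 * (k.factorial : ℚ))
      else (ArithmeticFunction.sigma (k - 1) n : ℚ) / ((k - 1).factorial : ℚ) := by
  rw [eisensteinG, map_add, coeff_bracket_singleton, PowerSeries.coeff_C]
  split_ifs with h
  · simp [h]
  · simp

theorem hasFourier_eisensteinG_two :
    HasFourier (complexify (eisensteinG 2)) ((-1 / 24 : ℂ) • E2) := by
  intro τ
  convert! (hasSum_qExpansion_E2 (z := τ)).mul_left (-1 / 24 : ℂ) using 2 with n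
  rw [PowerSeries.coeff_map, coeff_eisensteinG]
  split_ifs with h
  · norm_num [h, Nat.factorial]
  · simp [smul_eq_mul]
    ring

theorem hasFourier_eisensteinG {k : ℕ} (hk : 3 ≤ k) (hk2 : Even k) (hB : bernoulli k ≠ 0) :
    HasFourier (complexify (eisensteinG k))
      ((-(bernoulli k) / (2 * (k.factorial : ℚ)) : ℂ) • (E hk : ℍ → ℂ)) := by
  convert! (HasFourier.of_modularForm (E hk)).smul _ using 1
  ext n
  rw [PowerSeries.coeff_map, coeff_eisensteinG, PowerSeries.coeff_smul, E_qExpansion_coeff hk hk2]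
  split_ifs with h
  · simp
  · have h1 : k.factorial = k * (k - 1).factorial := (Nat.mul_factorial_pred (by omega)).symm
    have h2 : ((k - 1).factorial : ℂ) ≠ 0 := by exact_mod_cast (Nat.factorial_pos _).ne'
    have h3 : (k : ℂ) ≠ 0 := by exact_mod_cast (by omega : k ≠ 0)
    have h4 : (bernoulli k : ℂ) ≠ 0 := by exact_mod_cast hB
    rw [h1]
    simp only [eq_ratCast, Rat.cast_div, Rat.cast_natCast, smul_eq_mul, Nat.cast_mul]
    push_cast
    field_simp

/-! ### Invariant functions and the identities of Ramanujan -/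

/-- A holomorphic function on the upper half plane that transforms like a modular form of
weight `k`. -/
def IsWeaklyInvariant (k : ℤ) (f : ℍ → ℂ) : Prop :=
  MDifferentiable 𝓘(ℂ) 𝓘(ℂ) f ∧ ∀ γ : SL(2, ℤ), f ∣[k] γ = f

namespace IsWeaklyInvariant

theorem smul {k : ℤ} {f : ℍ → ℂ} (c : ℂ) (h : IsWeaklyInvariant k f) :
    IsWeaklyInvariant k (c • f) :=
  ⟨h.1.const_smul c, fun γ => by rw [ModularForm.SL_smul_slash, h.2]⟩

theorem add {k : ℤ} {f g : ℍ → ℂ} (hf : IsWeaklyInvariant k f) (hg : IsWeaklyInvariant k g) :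
    IsWeaklyInvariant k (f + g) :=
  ⟨hf.1.add hg.1, fun γ => by rw [SlashAction.add_slash, hf.2, hg.2]⟩

theorem sub {k : ℤ} {f g : ℍ → ℂ} (hf : IsWeaklyInvariant k f) (hg : IsWeaklyInvariant k g) :
    IsWeaklyInvariant k (f - g) := by
  have := hf.add (hg.smul (-1))
  rwa [neg_one_smul, ← sub_eq_add_neg] at this

theorem mul {k l : ℤ} {f g : ℍ → ℂ} (hf : IsWeaklyInvariant k f) (hg : IsWeaklyInvariant l g) :
    IsWeaklyInvariant (k + l) (f * g) :=
  ⟨hf.1.mul hg.1, fun γ => by rw [ModularForm.mul_slash_SL2, hf.2, hg.2]⟩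

theorem of_modularForm {k : ℤ} (f : ModularForm 𝒮ℒ k) : IsWeaklyInvariant k f :=
  ⟨f.holo', fun γ => f.slash_action_eq' _ ⟨γ, rfl⟩⟩

/-- The modular form given by an invariant function that is bounded at infinity. -/
def toModularForm {k : ℤ} {f : ℍ → ℂ} (hf : IsWeaklyInvariant k f)
    (hb : IsBoundedAtImInfty f) : ModularForm 𝒮ℒ k where
  toFun := f
  slash_action_eq' := fun _ ⟨γ, hγ⟩ => hγ ▸ hf.2 γ
  holo' := hf.1
  -- Boundedness at `∞` suffices, because slashing by `SL(2, ℤ)` moves any cusp to `∞` and leaves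
  -- `f` unchanged.
  bdd_at_cusps' {c} hc := by
    rw [Subgroup.IsArithmetic.isCusp_iff_isCusp_SL2Z] at hc
    rw [OnePoint.isBoundedAt_iff_forall_SL2Z hc]
    intro γ _
    rw [hf.2 γ]
    exact hb

theorem serre {k : ℤ} {f : ℍ → ℂ} (hf : IsWeaklyInvariant k f) :
    IsWeaklyInvariant (k + 2) (serreDerivative k f) :=
  ⟨serreDerivative_mdifferentiable _ hf.1, fun γ => serreDerivative_slash_invariant hf.1 (hf.2 γ)⟩

/-- A level one form of weight less than 12 with vanishing constant term vanishes. -/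
theorem eq_zero {k : ℕ} (hk : k < 12) {F : ℂ⟦X⟧} {f : ℍ → ℂ} (hf : IsWeaklyInvariant k f)
    (hF : HasFourier F f) (h0 : PowerSeries.coeff 0 F = 0) : F = 0 := by
  set g := hf.toModularForm hF.isBoundedAtImInfty
  have hg : HasFourier F g := hF
  have h1 := hg.eq_qExpansion
  have h2 : g = 0 := by
    refine sturm_bound_levelOne_nat ?_
    rw [← h1, Nat.div_eq_of_lt hk]
    have : (1 : ℕ∞) ≤ F.order := by
      refine PowerSeries.nat_le_order F 1 fun i hi => ?_
      rw [Nat.lt_one_iff.1 hi, h0]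
    exact lt_of_lt_of_le (by simp) this
  rw [h2] at hg
  exact hg.unique HasFourier.zero

end IsWeaklyInvariant

/-- The cocycle `c / (cz + d)`. -/
noncomputable def cocycle (γ : SL(2, ℤ)) (z : ℍ) : ℂ := (γ 1 0 : ℂ) / denom γ z

/-- The constant in the transformation law of `E₂`. -/
noncomputable def e2Const : ℂ := 12 * (2 * π * Complex.I)⁻¹

theorem e2Const_ne_zero : e2Const ≠ 0 :=
  mul_ne_zero (by norm_num) (inv_ne_zero two_pi_I_ne_zero)

theorem E2_slash_apply (γ : SL(2, ℤ)) (z : ℍ) :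
    (E2 ∣[(2 : ℤ)] γ) z = E2 z + e2Const * cocycle γ z := by
  rw [E2_slash_action]
  simp only [Pi.sub_apply, Pi.smul_apply, D2, riemannZeta_two, smul_eq_mul, cocycle, e2Const]
  have h1 : (π : ℂ) ≠ 0 := ofReal_ne_zero.2 Real.pi_ne_zero
  have h2 : Complex.I * Complex.I = -1 := I_mul_I
  have h3 : denom γ z ≠ 0 := denom_ne_zero _ z
  field_simp
  linear_combination (-12) * (γ 1 0 : ℂ) * h2

/-- Obtained by computing `D (E₂ ∣ γ)` in two ways: from the general commutation rule for `D` and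
the slash action, and by differentiating the transformation law of `E₂`. -/
theorem normalizedDeriv_E2_slash (γ : SL(2, ℤ)) (z : ℍ) :
    (D E2 ∣[(4 : ℤ)] γ) z = D E2 z + 2 * (2 * π * Complex.I)⁻¹ * cocycle γ z * E2 z +
      12 * (2 * π * Complex.I)⁻¹ ^ 2 * cocycle γ z ^ 2 := by
  have h := congrFun (normalizedDerivOfComplex_SL_slash (k := 2) E2_mdifferentiable (γ := γ)) z
  have h3 : denom γ z ≠ 0 := denom_ne_zero _ z
  have hd : HasDerivAt (fun w => e2Const * ((γ 1 0 : ℂ) * (denom γ w) ^ (-1 : ℤ)))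
      (e2Const * ((γ 1 0 : ℂ) * (-(γ 1 0 : ℂ) * (denom γ z) ^ (-2 : ℤ)))) z := by
    have := hasDerivAt_denom_zpow (γ : GL (Fin 2) ℝ) (-1) z
    simpa using (this.const_mul (γ 1 0 : ℂ)).const_mul e2Const
  have hE : HasDerivAt (E2 ∘ ofComplex) (deriv (E2 ∘ ofComplex) z) z :=
    (mdifferentiableAt_iff.mp (E2_mdifferentiable z)).hasDerivAt
  have h1 : deriv ((E2 ∣[(2 : ℤ)] γ) ∘ ofComplex) z = deriv (E2 ∘ ofComplex) z +
      e2Const * ((γ 1 0 : ℂ) * (-(γ 1 0 : ℂ) * (denom γ z) ^ (-2 : ℤ))) := by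
    rw [← (hE.add hd).deriv]
    refine Filter.EventuallyEq.deriv_eq ?_
    filter_upwards [isOpen_upperHalfPlaneSet.mem_nhds z.im_pos] with w hw
    rw [Function.comp_apply, E2_slash_apply, Pi.add_apply, Function.comp_apply, cocycle,
      ofComplex_apply_of_im_pos hw, zpow_neg_one, div_eq_mul_inv]
  have h2 : D (E2 ∣[(2 : ℤ)] γ) z = D E2 z -
      e2Const * (2 * π * Complex.I)⁻¹ * cocycle γ z ^ 2 := by
    rw [normalizedDerivOfComplex, h1, normalizedDerivOfComplex, cocycle]
    rw [zpow_neg, show (2 : ℤ) = ((2 : ℕ) : ℤ) from rfl, zpow_natCast]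
    field_simp
    ring
  rw [h2, Pi.sub_apply, E2_slash_apply] at h
  change _ = (D E2 ∣[(4 : ℤ)] γ) z - (2 : ℤ) * (2 * π * Complex.I)⁻¹ * cocycle γ z *
    (E2 z + e2Const * cocycle γ z) at h
  rw [e2Const] at h
  push_cast at h
  linear_combination -h

/-- The weight four form `D E₂ - E₂² / 12`. -/
theorem isWeaklyInvariant_E2 :
    IsWeaklyInvariant 4 (D E2 - (1 / 12 : ℂ) • (E2 * E2)) := by
  refine ⟨(normalizedDerivOfComplex_mdifferentiable E2_mdifferentiable).sub
    ((E2_mdifferentiable.mul E2_mdifferentiable).const_smul _), fun γ => ?_⟩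
  ext z
  rw [show D E2 - (1 / 12 : ℂ) • (E2 * E2) = D E2 + (-1 / 12 : ℂ) • (E2 * E2) by module,
    SlashAction.add_slash, ModularForm.SL_smul_slash,
    show (4 : ℤ) = 2 + 2 from rfl, ModularForm.mul_slash_SL2]
  simp only [Pi.add_apply, Pi.smul_apply, Pi.mul_apply, E2_slash_apply, smul_eq_mul]
  have := normalizedDeriv_E2_slash γ z
  rw [show (4 : ℤ) = 2 + 2 from rfl] at this
  -- The linear and quadratic cocycle terms of `D E₂` are `1/12` of those of `E₂²`.
  rw [this, e2Const]
  ring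

theorem bernoulli_four_eq : bernoulli 4 = -1 / 30 := by decide +kernel

theorem bernoulli_six_eq : bernoulli 6 = 1 / 42 := by decide +kernel

/-- The function with Fourier expansion `G₄`. -/
theorem hasFourier_eisensteinG_four :
    HasFourier (complexify (eisensteinG 4)) ((1 / 1440 : ℂ) • (E₄ : ℍ → ℂ)) := by
  have h := hasFourier_eisensteinG (k := 4) (by norm_num) ⟨2, rfl⟩ (by norm_num [bernoulli_four_eq])
  convert! h using 2
  norm_num [bernoulli_four_eq, Nat.factorial]

/-- The function with Fourier expansion `G₆`. -/
theorem hasFourier_eisensteinG_six :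
    HasFourier (complexify (eisensteinG 6)) ((-1 / 60480 : ℂ) • (E₆ : ℍ → ℂ)) := by
  have h := hasFourier_eisensteinG (k := 6) (by norm_num) ⟨3, rfl⟩ (by norm_num [bernoulli_six_eq])
  convert! h using 2
  norm_num [bernoulli_six_eq, Nat.factorial]

theorem coeff_zero_eisensteinG (k : ℕ) : PowerSeries.constantCoeff (eisensteinG k) =
    -(bernoulli k) / (2 * (k.factorial : ℚ)) := by
  rw [← PowerSeries.coeff_zero_eq_constantCoeff_apply, coeff_eisensteinG, if_pos rfl]

theorem constantCoeff_d (F : ℚ⟦X⟧) : PowerSeries.constantCoeff (d F) = 0 := by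
  rw [← PowerSeries.coeff_zero_eq_constantCoeff_apply, coeff_d, Nat.cast_zero, zero_mul]

theorem eq_zero_of_weight_lt {k : ℕ} (hk : k < 12) {F : ℚ⟦X⟧} {f : ℍ → ℂ}
    (hf : IsWeaklyInvariant k f) (hF : HasFourier (complexify F) f)
    (h0 : PowerSeries.coeff 0 F = 0) : F = 0 := by
  refine complexify_injective ?_
  rw [map_zero]
  exact hf.eq_zero hk hF (by rw [PowerSeries.coeff_map, h0, map_zero])

/-- The Serre derivative in terms of Fourier expansions. -/
theorem hasFourier_serre {F : ℚ⟦X⟧} {f : ℍ → ℂ} {k : ℕ} (hF : HasFourier (complexify F) f) :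
    HasFourier (complexify (d F + (2 * k : ℚ) • (eisensteinG 2 * F)))
      (serreDerivative (k : ℤ) f) := by
  rw [map_add, complexify_smul, map_mul]
  convert! (hasFourier_d hF).add ((hasFourier_eisensteinG_two.mul hF).smul _) using 1
  ext z
  simp only [serreDerivative_apply, Pi.add_apply, Pi.smul_apply, Pi.mul_apply, smul_eq_mul]
  push_cast
  ring

/-- The defect is the Fourier expansion of a combination of the weight 4 invariants `D E₂ - E₂²/12`
and `E₄`. Its constant term vanishes, hence so does the defect. -/
theorem ramanujan_two : d (eisensteinG 2) = 5 * eisensteinG 4 - 2 * eisensteinG 2 ^ 2 := by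
  have h5 : (5 : ℚ⟦X⟧) * eisensteinG 4 = (5 : ℚ) • eisensteinG 4 := by
    rw [PowerSeries.smul_eq_C_mul]
    rfl
  have h2 : (2 : ℚ⟦X⟧) * eisensteinG 2 ^ 2 = (2 : ℚ) • eisensteinG 2 ^ 2 := by
    rw [PowerSeries.smul_eq_C_mul]
    rfl
  rw [h5, h2, ← sub_eq_zero]
  have hinv := (isWeaklyInvariant_E2.smul (-1 / 24)).sub
    ((IsWeaklyInvariant.of_modularForm E₄).smul (1 / 288))
  have hF := (hasFourier_d hasFourier_eisensteinG_two).sub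
      ((hasFourier_eisensteinG_four.smul (5 : ℚ)).sub
      ((hasFourier_eisensteinG_two.mul hasFourier_eisensteinG_two).smul (2 : ℚ)))
  have heq : D ((-1 / 24 : ℂ) • E2) - (((5 : ℚ) : ℂ) • (1 / 1440 : ℂ) • (E₄ : ℍ → ℂ) -
      ((2 : ℚ) : ℂ) • ((-1 / 24 : ℂ) • E2 * (-1 / 24 : ℂ) • E2)) =
      (-1 / 24 : ℂ) • (D E2 - (1 / 12 : ℂ) • (E2 * E2)) - (1 / 288 : ℂ) • (E₄ : ℍ → ℂ) := by
    rw [normalizedDerivOfComplex_smul _ _ E2_mdifferentiable]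
    ext z
    simp only [Pi.sub_apply, Pi.smul_apply, Pi.mul_apply, smul_eq_mul]
    push_cast
    ring
  rw [heq] at hF
  refine eq_zero_of_weight_lt (k := 4) (by norm_num) hinv ?_ ?_
  · simpa only [map_sub, complexify_smul, map_mul, sq] using hF
  · norm_num [constantCoeff_d, coeff_zero_eisensteinG, bernoulli_four_eq, Nat.factorial]

/-- The identity says that the Serre derivative of `G₄` is `14 G₆`; both sides have weight 6, so
constant terms suffice. For `G₆` the same argument runs in weight 8. -/
theorem ramanujan_four :
    d (eisensteinG 4) = 14 * eisensteinG 6 - 8 * eisensteinG 2 * eisensteinG 4 := by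
  have h14 : (14 : ℚ⟦X⟧) * eisensteinG 6 = (14 : ℚ) • eisensteinG 6 := by
    rw [PowerSeries.smul_eq_C_mul]
    rfl
  have h8 : (8 : ℚ⟦X⟧) * eisensteinG 2 * eisensteinG 4 =
      (2 * (4 : ℕ) : ℚ) • (eisensteinG 2 * eisensteinG 4) := by
    rw [PowerSeries.smul_eq_C_mul, mul_assoc]
    congr 1
    norm_num
    rfl
  rw [h14, h8, eq_sub_iff_add_eq, ← sub_eq_zero]
  have h4 := (IsWeaklyInvariant.of_modularForm E₄).smul (1 / 1440)
  refine eq_zero_of_weight_lt (k := 6) (by norm_num)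
    (h4.serre.sub (((IsWeaklyInvariant.of_modularForm E₆).smul (-1 / 60480)).smul (14 : ℚ))) ?_ ?_
  · rw [map_sub, complexify_smul]
    exact (hasFourier_serre (k := 4) hasFourier_eisensteinG_four).sub
      (hasFourier_eisensteinG_six.smul _)
  · norm_num [constantCoeff_d, coeff_zero_eisensteinG, bernoulli_four_eq, bernoulli_six_eq, Nat.factorial]

theorem ramanujan_six : d (eisensteinG 6) =
    (120 / 7 : ℚ) • eisensteinG 4 ^ 2 - 12 * eisensteinG 2 * eisensteinG 6 := by
  have h12 : (12 : ℚ⟦X⟧) * eisensteinG 2 * eisensteinG 6 =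
      (2 * (6 : ℕ) : ℚ) • (eisensteinG 2 * eisensteinG 6) := by
    rw [PowerSeries.smul_eq_C_mul, mul_assoc]
    congr 1
    norm_num
    rfl
  rw [h12, eq_sub_iff_add_eq, ← sub_eq_zero]
  have h4 := (IsWeaklyInvariant.of_modularForm E₄).smul (1 / 1440)
  have h6 := (IsWeaklyInvariant.of_modularForm E₆).smul (-1 / 60480)
  refine eq_zero_of_weight_lt (k := 8) (by norm_num)
    (h6.serre.sub ((h4.mul h4).smul (120 / 7 : ℚ))) ?_ ?_
  · rw [map_sub, complexify_smul, sq, map_mul]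
    exact (hasFourier_serre (k := 6) hasFourier_eisensteinG_six).sub
      ((hasFourier_eisensteinG_four.mul hasFourier_eisensteinG_four).smul _)
  · norm_num [constantCoeff_d, coeff_zero_eisensteinG, bernoulli_four_eq, bernoulli_six_eq, Nat.factorial]

/-! ### Structure of modular and quasi-modular forms -/

/-- The span of the functions `E₂ᵃ E₄ᵇ E₆ᶜ` with `2a + 4b + 6c = k`. -/
noncomputable def quasiFunctions (k : ℕ) : Submodule ℂ (ℍ → ℂ) :=
  Submodule.span ℂ {f | ∃ a b c : ℕ, 2 * a + 4 * b + 6 * c = k ∧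
    f = E2 ^ a * (E₄ : ℍ → ℂ) ^ b * (E₆ : ℍ → ℂ) ^ c}

theorem quasiFunctions_mul_mem {k l : ℕ} {f g : ℍ → ℂ} (hf : f ∈ quasiFunctions k)
    (hg : g ∈ quasiFunctions l) : f * g ∈ quasiFunctions (k + l) := by
  have := Submodule.mul_mem_mul hf hg
  rw [quasiFunctions, quasiFunctions, Submodule.span_mul_span] at this
  refine Submodule.span_le.2 ?_ this
  rintro _ ⟨_, ⟨a, b, c, h, rfl⟩, _, ⟨a', b', c', h', rfl⟩, rfl⟩
  refine Submodule.subset_span ⟨a + a', b + b', c + c', by omega, ?_⟩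
  simp only [pow_add]
  ring

theorem monomial_mem_quasiFunctions (a b c : ℕ) :
    E2 ^ a * (E₄ : ℍ → ℂ) ^ b * (E₆ : ℍ → ℂ) ^ c ∈ quasiFunctions (2 * a + 4 * b + 6 * c) :=
  Submodule.subset_span ⟨a, b, c, rfl, rfl⟩

theorem discriminant_mem_quasiFunctions :
    (ModularForm.discriminant : ℍ → ℂ) ∈ quasiFunctions 12 := by
  have h : (ModularForm.discriminant : ℍ → ℂ) =
      (1 / 1728 : ℂ) • (E2 ^ 0 * (E₄ : ℍ → ℂ) ^ 3 * (E₆ : ℍ → ℂ) ^ 0 -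
        E2 ^ 0 * (E₄ : ℍ → ℂ) ^ 0 * (E₆ : ℍ → ℂ) ^ 2) := by
    ext z
    simp only [discriminant_eq_E₄_cube_sub_E₆_sq, Pi.smul_apply, Pi.sub_apply, Pi.mul_apply,
      Pi.pow_apply, smul_eq_mul]
    ring
  rw [h]
  exact Submodule.smul_mem _ _ (Submodule.sub_mem _ (monomial_mem_quasiFunctions 0 3 0)
    (monomial_mem_quasiFunctions 0 0 2))

/-- Modular forms of level one are polynomials in `E₄` and `E₆`. -/
theorem modularForm_mem_quasiFunctions (k : ℕ) (f : ModularForm 𝒮ℒ (k : ℤ)) :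
    (f : ℍ → ℂ) ∈ quasiFunctions k := by
  induction k using Nat.strong_induction_on with
  | _ k ih =>
    rcases Nat.even_or_odd k with hk | hk
    · rcases eq_or_ne k 0 with rfl | h0
      · obtain ⟨c, hc⟩ := ModularFormClass.levelOne_weight_zero_const (F := ModularForm 𝒮ℒ 0) f
        have : (f : ℍ → ℂ) = c • (E2 ^ 0 * (E₄ : ℍ → ℂ) ^ 0 * (E₆ : ℍ → ℂ) ^ 0) := by
          rw [hc]
          ext z
          simp
        rw [this]
        exact Submodule.smul_mem _ _ (monomial_mem_quasiFunctions 0 0 0)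
      rcases eq_or_ne k 2 with rfl | h2
      · have : f = 0 := rank_zero_iff_forall_zero.mp levelOne_weight_two_rank_zero f
        rw [this]
        exact Submodule.zero_mem _
      -- If `k ≡ 2 mod 4`, one factor `E₆` corrects the residue; this needs `k ≥ 6`, which holds as
      -- `k ≠ 2`.
      obtain ⟨b, c, hbc⟩ : ∃ b c : ℕ, 4 * b + 6 * c = k := by
        obtain ⟨m, rfl⟩ := hk
        rcases Nat.even_or_odd' m with ⟨n, rfl | rfl⟩
        · exact ⟨n, 0, by omega⟩
        · exact ⟨n - 1, 1, by omega⟩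
      have hm : (E2 ^ 0 * (E₄ : ℍ → ℂ) ^ b * (E₆ : ℍ → ℂ) ^ c) ∈ quasiFunctions k := by
        have := monomial_mem_quasiFunctions 0 b c
        rwa [show 2 * 0 + 4 * b + 6 * c = k by omega] at this
      set m : ModularForm 𝒮ℒ (k : ℤ) := ((E₄.pow b).mul (E₆.pow c)).mcast
        (by rw [← hbc]; push_cast; ring) with hmdef
      have hmcoe : (m : ℍ → ℂ) = E2 ^ 0 * (E₄ : ℍ → ℂ) ^ b * (E₆ : ℍ → ℂ) ^ c := by
        simp [hmdef]
      have hm0 : (qExpansion 1 m).coeff 0 = 1 := by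
        have h1 : qExpansion 1 m = qExpansion 1 E₄ ^ b * qExpansion 1 E₆ ^ c := by
          rw [hmdef, ModularForm.qExpansion_mcast,
            ModularForm.qExpansion_mul one_pos one_mem_strictPeriods_SL,
            ModularForm.qExpansion_pow one_pos one_mem_strictPeriods_SL,
            ModularForm.qExpansion_pow one_pos one_mem_strictPeriods_SL]
        have h4 := E_qExpansion_coeff_zero (k := 4) (by norm_num) ⟨2, rfl⟩
        have h6 := E_qExpansion_coeff_zero (k := 6) (by norm_num) ⟨3, rfl⟩
        rw [PowerSeries.coeff_zero_eq_constantCoeff_apply] at h4 h6 ⊢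
        rw [h1, map_mul, map_pow, map_pow, h4, h6]
        simp
      set a := (qExpansion 1 f).coeff 0
      -- Removing the constant term leaves a cusp form, which is the discriminant times a form of
      -- weight `k - 12`.
      set h := f - a • m with hh
      have hh0 : (qExpansion 1 h).coeff 0 = 0 := by
        have hF : HasFourier (qExpansion 1 f - a • qExpansion 1 m) h :=
          (HasFourier.of_modularForm f).sub ((HasFourier.of_modularForm m).smul a)
        rw [← hF.eq_qExpansion, map_sub, PowerSeries.coeff_smul, hm0]
        simp [a]
      have hΔ := discriminant_mul_discriminantEquiv (toCuspForm h hh0)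
      set g := CuspForm.discriminantEquiv (toCuspForm h hh0)
      have hfh : (f : ℍ → ℂ) = h + a • (m : ℍ → ℂ) := by
        ext z
        simp [hh]
      rw [hfh, hmcoe]
      refine Submodule.add_mem _ ?_ (Submodule.smul_mem _ _ hm)
      have hcoe : (h : ℍ → ℂ) = ModularForm.discriminant * (g : ℍ → ℂ) := hΔ.symm
      rw [hcoe]
      rcases lt_or_ge k 12 with hk12 | hk12
      · have : (g : ℍ → ℂ) = 0 := ModularFormClass.levelOne_neg_weight_eq_zero (by omega) g
        rw [this, mul_zero]
        exact Submodule.zero_mem _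
      · have hg := ih (k - 12) (by omega) (g.mcast (by omega))
        have := quasiFunctions_mul_mem discriminant_mem_quasiFunctions hg
        rwa [show 12 + (k - 12) = k by omega] at this
    · rw [ModularForm.levelOne_odd_weight_eq_zero (by exact_mod_cast hk) f]
      exact Submodule.zero_mem _

theorem cocycle_mul (A B : SL(2, ℤ)) (z : ℍ) :
    cocycle (A * B) z = cocycle A (B • z) * (denom B z ^ 2)⁻¹ + cocycle B z := by
  have h := congrFun (D2_mul A B) z
  have hπ := two_pi_I_ne_zero
  have hD : ∀ (γ : SL(2, ℤ)) (w : ℍ), D2 γ w = 2 * π * Complex.I * cocycle γ w := by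
    intro γ w
    rw [D2, cocycle, mul_div_assoc]
  rw [Pi.add_apply, ModularForm.SL_slash_apply, hD, hD, hD, zpow_neg,
    show (2 : ℤ) = ((2 : ℕ) : ℤ) from rfl, zpow_natCast] at h
  refine mul_left_cancel₀ hπ ?_
  rw [h]
  ring

/-- The matrix `(1 t; c 1 + ct)`. -/
def lowerUpper (c t : ℤ) : SL(2, ℤ) := ⟨!![1, t; c, 1 + c * t], by simp [Matrix.det_fin_two]; ring⟩

theorem denom_lowerUpper (c t : ℤ) (z : ℍ) : denom (lowerUpper c t) z = c * (z + t) + 1 := by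
  rw [ModularGroup.denom_apply]
  simp [lowerUpper]
  ring

theorem cocycle_lowerUpper (c t : ℤ) (z : ℍ) :
    cocycle (lowerUpper c t) z = c / (c * (z + t) + 1) := by
  rw [cocycle, denom_lowerUpper]
  simp [lowerUpper]

/-- The cocycle takes infinitely many values with given lower left entry. -/
theorem injective_cocycle_lowerUpper {c : ℤ} (hc : c ≠ 0) (z : ℍ) :
    Function.Injective fun t => cocycle (lowerUpper c t) z := by
  intro t s h
  have h1 : denom (lowerUpper c t) z ≠ 0 := denom_ne_zero _ z
  have h2 : denom (lowerUpper c s) z ≠ 0 := denom_ne_zero _ z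
  rw [denom_lowerUpper] at h1 h2
  simp only [cocycle_lowerUpper] at h
  have hc' : (c : ℂ) ≠ 0 := by exact_mod_cast hc
  rw [div_eq_div_iff h1 h2] at h
  have h3 := mul_left_cancel₀ hc' h
  have h4 : (c : ℂ) * (s - t) = 0 := by linear_combination h3
  rcases mul_eq_zero.1 h4 with h5 | h5
  · exact absurd h5 hc'
  · exact_mod_cast (sub_eq_zero.1 h5).symm

/-- The entry `c` is a parameter because the independence of weights holds it fixed while `t`
supplies infinitely many values. -/
theorem polynomial_eq_of_cocycle {P Q : Polynomial ℂ} (c : ℤ) (hc : c ≠ 0) (z : ℍ)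
    (h : ∀ t, P.eval (cocycle (lowerUpper c t) z) = Q.eval (cocycle (lowerUpper c t) z)) :
    P = Q := by
  refine Polynomial.eq_of_infinite_eval_eq P Q ?_
  refine (Set.infinite_range_of_injective (injective_cocycle_lowerUpper hc z)).mono ?_
  rintro _ ⟨t, rfl⟩
  exact h t

theorem eq_of_forall_cocycle {P Q : Polynomial ℂ} (z : ℍ)
    (h : ∀ γ : SL(2, ℤ), P.eval (cocycle γ z) = Q.eval (cocycle γ z)) : P = Q :=
  polynomial_eq_of_cocycle 1 one_ne_zero z fun _ => h _

/-- The leading coefficient of a quasi-modular transformation law is a modular form. -/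
theorem slash_top_coefficient {k p : ℕ} {f : ℍ → ℂ} {g : ℕ → ℍ → ℂ}
    (hf : ∀ (γ : SL(2, ℤ)) (z : ℍ),
      (f ∣[(k : ℤ)] γ) z = ∑ j ∈ Finset.range (p + 1), g j z * cocycle γ z ^ j)
    (γ : SL(2, ℤ)) : g p ∣[(k : ℤ) - 2 * p] γ = g p := by
  ext z
  set J := denom γ z with hJ
  have hJ0 : J ≠ 0 := denom_ne_zero _ z
  set P : Polynomial ℂ := ∑ j ∈ Finset.range (p + 1), Polynomial.C (g j z) * Polynomial.X ^ j
  set Q : Polynomial ℂ := ∑ j ∈ Finset.range (p + 1), Polynomial.C (J ^ (-(k : ℤ)) *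
    g j (γ • z) * (J ^ 2) ^ j) * (Polynomial.X - Polynomial.C (cocycle γ z)) ^ j
  have hPQ : P = Q := by
    -- At the cocycle of `δ` both polynomials compute `f ∣ δ`, the second one as `(f ∣ δγ⁻¹) ∣ γ`
    -- through the cocycle relation.
    refine eq_of_forall_cocycle z fun δ => ?_
    have h1 := hf δ z
    have h2 : f ∣[(k : ℤ)] δ = (f ∣[(k : ℤ)] (δ * γ⁻¹)) ∣[(k : ℤ)] γ := by
      rw [← SlashAction.slash_mul, inv_mul_cancel_right]
    have h3 := cocycle_mul (δ * γ⁻¹) γ z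
    rw [inv_mul_cancel_right] at h3
    rw [h2, ModularForm.SL_slash_apply, hf] at h1
    simp only [P, Q, Polynomial.eval_finsetSum, Polynomial.eval_mul, Polynomial.eval_C,
      Polynomial.eval_pow, Polynomial.eval_X, Polynomial.eval_sub]
    rw [← h1, Finset.sum_mul]
    refine Finset.sum_congr rfl fun j _ => ?_
    have h4 : cocycle (δ * γ⁻¹) (γ • z) = J ^ 2 * (cocycle δ z - cocycle γ z) := by
      rw [h3, add_sub_cancel_right, ← hJ]
      field_simp
    rw [h4, mul_pow]
    ring
  have hP : P.coeff p = g p z := by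
    simp only [P, Polynomial.finsetSum_coeff, Polynomial.coeff_C_mul, Polynomial.coeff_X_pow]
    rw [Finset.sum_eq_single p]
    · simp
    · intro j _ hj
      simp [hj.symm]
    · simp
  have hQ : Q.coeff p = J ^ (-(k : ℤ)) * g p (γ • z) * (J ^ 2) ^ p := by
    simp only [Q, Polynomial.finsetSum_coeff, Polynomial.coeff_C_mul]
    -- Only the summand `j = p` has degree `p`, and its power of `X - C _` is monic.
    rw [Finset.sum_range_succ, Finset.sum_eq_zero, zero_add]
    · have hmonic := (Polynomial.monic_X_sub_C (cocycle γ z)).pow p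
      have hdeg : ((Polynomial.X - Polynomial.C (cocycle γ z)) ^ p).natDegree = p := by
        rw [Polynomial.natDegree_pow, Polynomial.natDegree_X_sub_C, mul_one]
      have := hmonic.coeff_natDegree
      rw [hdeg] at this
      rw [this, mul_one]
    · intro j hj
      rw [Finset.mem_range] at hj
      rw [Polynomial.coeff_eq_zero_of_natDegree_lt, mul_zero]
      rwa [Polynomial.natDegree_pow, Polynomial.natDegree_X_sub_C, mul_one]
  rw [ModularForm.SL_slash_apply, ← hP, hPQ, hQ, ← hJ,
    show -((k : ℤ) - 2 * p) = -(k : ℤ) + ((2 * p : ℕ) : ℤ) by push_cast; ring,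
    zpow_add₀ hJ0, zpow_natCast, pow_mul]
  ring

/-- Induction on the depth. The top coefficient is modular of weight `k - 2p`, and its product with
a suitably normalised `E₂ ^ p` has the same top cocycle term as `f`; the difference has smaller
depth. -/
theorem quasiModular_depth_mem {k p : ℕ} {f : ℍ → ℂ} {g : ℕ → ℍ → ℂ}
    (hg : ∀ j ≤ p, MDifferentiable 𝓘(ℂ) 𝓘(ℂ) (g j) ∧ IsBoundedAtImInfty (g j))
    (hf : ∀ (γ : SL(2, ℤ)) (z : ℍ),
      (f ∣[(k : ℤ)] γ) z = ∑ j ∈ Finset.range (p + 1), g j z * cocycle γ z ^ j) :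
    f ∈ quasiFunctions k := by
  induction p generalizing f g with
  | zero =>
    have hs : ∀ γ : SL(2, ℤ), f ∣[(k : ℤ)] γ = g 0 := fun γ => by
      ext z
      simpa using hf γ z
    have hfg : f = g 0 := by simpa using hs 1
    have hw : IsWeaklyInvariant k f := ⟨hfg ▸ (hg 0 le_rfl).1, fun γ => (hs γ).trans hfg.symm⟩
    exact modularForm_mem_quasiFunctions k (hw.toModularForm (hfg ▸ (hg 0 le_rfl).2))
  | succ p ih =>
    have htop := slash_top_coefficient hf
    have hw : IsWeaklyInvariant ((k : ℤ) - 2 * (p + 1 : ℕ)) (g (p + 1)) :=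
      ⟨(hg _ le_rfl).1, htop⟩
    set m := hw.toModularForm (hg _ le_rfl).2
    -- Normalised so that the coefficient of the top cocycle power in `t ∣ γ` is `g (p + 1)`.
    set c : ℂ := (e2Const ^ (p + 1))⁻¹
    set t : ℍ → ℂ := c • (g (p + 1) * E2 ^ (p + 1)) with ht
    have htmem : t ∈ quasiFunctions k := by
      refine Submodule.smul_mem _ _ ?_
      -- If the weight of the top coefficient is negative, that coefficient vanishes.
      rcases lt_or_ge k (2 * (p + 1)) with hlt | hge
      · have : g (p + 1) = 0 :=
          ModularFormClass.levelOne_neg_weight_eq_zero (by push_cast; omega) m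
        rw [this, zero_mul]
        exact Submodule.zero_mem _
      · have h1 := modularForm_mem_quasiFunctions (k - 2 * (p + 1))
          (m.mcast (by push_cast [hge]; ring))
        have h2 := monomial_mem_quasiFunctions (p + 1) 0 0
        have h3 := quasiFunctions_mul_mem h1 h2
        rw [pow_zero, pow_zero, mul_one, mul_one,
          show k - 2 * (p + 1) + (2 * (p + 1) + 4 * 0 + 6 * 0) = k by omega] at h3
        exact h3
    have hE2pow : ∀ (n : ℕ) (γ : SL(2, ℤ)) (z : ℍ), (E2 ^ n) (γ • z) * denom γ z ^ (-(2 * n : ℤ)) =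
        (E2 z + e2Const * cocycle γ z) ^ n := by
      intro n γ z
      rw [← E2_slash_apply, ModularForm.SL_slash_apply, mul_pow, Pi.pow_apply, ← zpow_natCast,
        ← zpow_natCast, ← zpow_mul]
      congr 2
    have htslash : ∀ (γ : SL(2, ℤ)) (z : ℍ), (t ∣[(k : ℤ)] γ) z =
        c * (g (p + 1) z * (E2 z + e2Const * cocycle γ z) ^ (p + 1)) := by
      intro γ z
      have hJ0 : denom γ z ≠ 0 := denom_ne_zero _ z
      have h1 := congrFun (htop γ) z
      rw [ModularForm.SL_slash_apply] at h1
      rw [← hE2pow, ← h1, ModularForm.SL_slash_apply, ht,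
        show -(k : ℤ) = -((k : ℤ) - 2 * (p + 1 : ℕ)) + -(2 * (p + 1 : ℕ)) by ring,
        zpow_add₀ hJ0]
      simp only [Pi.smul_apply, Pi.mul_apply, smul_eq_mul]
      ring
    have hsub : f - t ∈ quasiFunctions k := by
      -- The subtracted terms are the binomial expansion of `(E₂ + e2Const * cocycle) ^ (p + 1)`.
      refine ih (g := fun j => g j - (c * e2Const ^ j * ((p + 1).choose j : ℂ)) •
        (g (p + 1) * E2 ^ (p + 1 - j))) (fun j hj => ?_) fun γ z => ?_
      · have hd : ∀ n : ℕ, MDifferentiable 𝓘(ℂ) 𝓘(ℂ) (E2 ^ n) := fun n =>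
          E2_mdifferentiable.pow n
        have hb : ∀ n : ℕ, IsBoundedAtImInfty (E2 ^ n) := by
          intro n
          induction n with
          | zero => exact Filter.const_boundedAtFilter _ 1
          | succ n ihn =>
            rw [pow_succ]
            exact ihn.mul isBoundedAtImInfty_E2
        have hd1 := ((hg _ le_rfl).1.mul (hd (p + 1 - j))).const_smul
          (c * e2Const ^ j * ((p + 1).choose j : ℂ))
        have hb1 := ((hg _ le_rfl).2.mul (hb (p + 1 - j))).smul
          (c * e2Const ^ j * ((p + 1).choose j : ℂ))
        refine ⟨(hg j (by omega)).1.sub hd1, ?_⟩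
        rw [sub_eq_add_neg]
        exact (hg j (by omega)).2.add hb1.neg
      · rw [sub_eq_add_neg, SlashAction.add_slash, SlashAction.neg_slash, Pi.add_apply,
          Pi.neg_apply, htslash, hf, add_comm (E2 z), add_pow, Finset.mul_sum, Finset.mul_sum,
          ← sub_eq_add_neg, ← Finset.sum_sub_distrib, Finset.sum_range_succ]
        have hc0 : c * e2Const ^ (p + 1) = 1 :=
          inv_mul_cancel₀ (pow_ne_zero _ e2Const_ne_zero)
        have hlast : g (p + 1) z * cocycle γ z ^ (p + 1) -
            c * (g (p + 1) z * ((e2Const * cocycle γ z) ^ (p + 1) *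
              E2 z ^ (p + 1 - (p + 1)) * ((p + 1).choose (p + 1) : ℂ))) = 0 := by
          rw [Nat.sub_self, Nat.choose_self, mul_pow]
          push_cast
          linear_combination (-(g (p + 1) z * cocycle γ z ^ (p + 1))) * hc0
        rw [hlast, add_zero]
        refine Finset.sum_congr rfl fun j _ => ?_
        simp only [Pi.sub_apply, Pi.smul_apply, Pi.mul_apply, Pi.pow_apply, smul_eq_mul, mul_pow]
        ring
    have := Submodule.add_mem _ hsub htmem
    rwa [sub_add_cancel] at this

/-- Quasi-modular forms of level one are polynomials in `E₂`, `E₄` and `E₆`. -/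
theorem IsQuasiModularForm.mem_quasiFunctions {k : ℕ} {f : ℍ → ℂ} (h : IsQuasiModularForm k f) :
    f ∈ quasiFunctions k := by
  obtain ⟨p, g, hg, hf⟩ := h
  exact quasiModular_depth_mem hg hf

theorem isQuasiModularForm_one : IsQuasiModularForm 0 1 :=
  ⟨0, fun _ => 1, fun _ _ => ⟨mdifferentiable_const, Filter.const_boundedAtFilter _ 1⟩,
    fun γ z => by simp [ModularForm.SL_slash_apply]⟩

theorem IsQuasiModularForm.of_modularForm {k : ℕ} (f : ModularForm 𝒮ℒ (k : ℤ)) :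
    IsQuasiModularForm k f :=
  ⟨0, fun _ => f, fun _ _ => ⟨f.holo', (HasFourier.of_modularForm f).isBoundedAtImInfty⟩,
    fun γ z => by simp [(IsWeaklyInvariant.of_modularForm f).2 γ]⟩

theorem IsQuasiModularForm.mul_modularForm {k l : ℕ} {f : ℍ → ℂ} (hf : IsQuasiModularForm k f)
    (h : ModularForm 𝒮ℒ (l : ℤ)) : IsQuasiModularForm (k + l) (f * h) := by
  obtain ⟨p, g, hg, hf⟩ := hf
  have hb := (HasFourier.of_modularForm h).isBoundedAtImInfty
  refine ⟨p, fun j => g j * h, fun j hj => ⟨(hg j hj).1.mul h.holo', (hg j hj).2.mul hb⟩,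
    fun γ z => ?_⟩
  rw [Nat.cast_add, ModularForm.mul_slash_SL2, Pi.mul_apply, hf,
    (IsWeaklyInvariant.of_modularForm h).2 γ, Finset.sum_mul]
  refine Finset.sum_congr rfl fun j _ => ?_
  simp only [Pi.mul_apply]
  ring

/-- The factor `E₂ + e2Const * cocycle` adds to the coefficients times `E₂` a copy shifted by one
power of the cocycle. The `if j ≤ p` is needed because nothing is known about `g j` beyond `p`. -/
theorem IsQuasiModularForm.mul_E2 {k : ℕ} {f : ℍ → ℂ} (hf : IsQuasiModularForm k f) :
    IsQuasiModularForm (k + 2) (f * E2) := by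
  obtain ⟨p, g, hg, hf⟩ := hf
  refine ⟨p + 1, fun j => (if j ≤ p then g j * E2 else 0) +
    (if j = 0 then 0 else e2Const • g (j - 1)), fun j hj => ⟨?_, ?_⟩, fun γ z => ?_⟩
  · refine MDifferentiable.add ?_ ?_
    · split_ifs with h
      · exact (hg j h).1.mul E2_mdifferentiable
      · exact mdifferentiable_const
    · split_ifs with h
      · exact mdifferentiable_const
      · exact (hg (j - 1) (by omega)).1.const_smul _
  · refine Filter.BoundedAtFilter.add ?_ ?_
    · split_ifs with h
      · exact (hg j h).2.mul isBoundedAtImInfty_E2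
      · exact Filter.const_boundedAtFilter _ 0
    · split_ifs with h
      · exact Filter.const_boundedAtFilter _ 0
      · exact (hg (j - 1) (by omega)).2.smul _
  · rw [Nat.cast_add, Nat.cast_ofNat, ModularForm.mul_slash_SL2, Pi.mul_apply, hf, E2_slash_apply]
    simp only [Pi.add_apply, add_mul, Finset.sum_add_distrib]
    rw [Finset.sum_range_succ _ (p + 1), Finset.sum_range_succ' _ (p + 1), mul_add]
    simp only [show ¬ p + 1 ≤ p by omega, if_false, if_true, Pi.zero_apply, zero_mul, add_zero,
      Nat.add_eq_zero_iff, one_ne_zero, and_false, Nat.add_sub_cancel]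
    rw [Finset.sum_mul, Finset.sum_mul]
    congr 1
    · refine Finset.sum_congr rfl fun j hj => ?_
      rw [if_pos (Nat.lt_succ_iff.1 (Finset.mem_range.1 hj)), Pi.mul_apply]
      ring
    · refine Finset.sum_congr rfl fun j hj => ?_
      rw [Pi.smul_apply, smul_eq_mul, cocycle]
      ring

theorem isQuasiModularForm_monomial (a b c : ℕ) : IsQuasiModularForm (2 * a + 4 * b + 6 * c)
    (E2 ^ a * (E₄ : ℍ → ℂ) ^ b * (E₆ : ℍ → ℂ) ^ c) := by
  induction c with
  | zero =>
    rw [pow_zero, mul_one, mul_zero, add_zero]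
    induction b with
    | zero =>
      rw [pow_zero, mul_one, mul_zero, add_zero]
      induction a with
      | zero => exact isQuasiModularForm_one
      | succ a ih =>
        rw [pow_succ]
        exact ih.mul_E2
    | succ b ih =>
      rw [pow_succ, ← mul_assoc]
      exact ih.mul_modularForm (l := 4) E₄
  | succ c ih =>
    rw [pow_succ, ← mul_assoc]
    exact ih.mul_modularForm (l := 6) E₆

/-! ### Descent to rational coefficients and the graded algebras -/

/-- A rational power series in the complex span of rational power series is in their
rational span. -/
theorem mem_span_of_complexify_mem {S : Set ℚ⟦X⟧} {F : ℚ⟦X⟧}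
    (hF : complexify F ∈ Submodule.span ℂ (complexify '' S)) : F ∈ Submodule.span ℚ S := by
  obtain ⟨r, hr⟩ := LinearMap.exists_leftInverse_of_injective (Algebra.linearMap ℚ ℂ)
    (LinearMap.ker_eq_bot.2 (algebraMap ℚ ℂ).injective)
  have hr1 : ∀ x : ℚ, r (x : ℂ) = x := fun x => by
    have := LinearMap.congr_fun hr x
    simpa using this
  set R : ℂ⟦X⟧ → ℚ⟦X⟧ := fun G => PowerSeries.mk fun n => r (PowerSeries.coeff n G) with hR
  have hRadd : ∀ G H, R (G + H) = R G + R H := fun G H => by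
    ext n
    simp [hR]
  have hRsmul : ∀ (c : ℂ) (G : ℚ⟦X⟧), R (c • complexify G) = r c • G := fun c G => by
    ext n
    have : c * ((PowerSeries.coeff n G : ℚ) : ℂ) = (PowerSeries.coeff n G) • c := by
      rw [mul_comm, Rat.smul_def]
    simp only [hR, PowerSeries.coeff_mk, PowerSeries.coeff_map,
      smul_eq_mul, eq_ratCast, this, map_smul]
    ring
  -- `R` is only `ℚ`-linear, so the induction carries an arbitrary complex factor `c` to pass
  -- through scalar multiplication.
  have key : ∀ G ∈ Submodule.span ℂ (complexify '' S), ∀ c : ℂ,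
      R (c • G) ∈ Submodule.span ℚ S := by
    intro G hG
    induction hG using Submodule.span_induction with
    | mem x hx =>
      obtain ⟨G, hG, rfl⟩ := hx
      intro c
      rw [hRsmul]
      exact Submodule.smul_mem _ _ (Submodule.subset_span hG)
    | zero =>
      intro c
      have : R (c • 0) = 0 := by
        ext n
        simp [hR]
      rw [this]
      exact Submodule.zero_mem _
    | add x y _ _ hx hy =>
      intro c
      rw [smul_add, hRadd]
      exact Submodule.add_mem _ (hx c) (hy c)
    | smul a x _ hx =>
      intro c
      rw [smul_smul]
      exact hx _
  have h1 := key _ hF 1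
  rw [hRsmul, show (1 : ℂ) = ((1 : ℚ) : ℂ) by norm_num, hr1, one_smul] at h1
  exact h1

/-- The normalised Eisenstein series of weight two. -/
noncomputable def seriesE2 : ℚ⟦X⟧ := (-24 : ℚ) • eisensteinG 2

/-- The normalised Eisenstein series of weight four. -/
noncomputable def seriesE4 : ℚ⟦X⟧ := (1440 : ℚ) • eisensteinG 4

/-- The normalised Eisenstein series of weight six. -/
noncomputable def seriesE6 : ℚ⟦X⟧ := (-60480 : ℚ) • eisensteinG 6

theorem hasFourier_seriesE2 : HasFourier (complexify seriesE2) E2 := by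
  have h := hasFourier_eisensteinG_two.smul (-24 : ℚ)
  rw [smul_smul] at h
  rw [seriesE2, complexify_smul]
  convert h using 1
  norm_num

theorem hasFourier_seriesE4 : HasFourier (complexify seriesE4) E₄ := by
  have h := hasFourier_eisensteinG_four.smul (1440 : ℚ)
  rw [smul_smul] at h
  rw [seriesE4, complexify_smul]
  convert h using 1
  norm_num

theorem hasFourier_seriesE6 : HasFourier (complexify seriesE6) E₆ := by
  have h := hasFourier_eisensteinG_six.smul (-60480 : ℚ)
  rw [smul_smul] at h
  rw [seriesE6, complexify_smul]
  convert h using 1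
  norm_num

theorem HasFourier.pow {F : ℂ⟦X⟧} {f : ℍ → ℂ} (h : HasFourier F f) (n : ℕ) :
    HasFourier (F ^ n) (f ^ n) := by
  induction n with
  | zero => simpa using HasFourier.one
  | succ n ih =>
    rw [pow_succ, pow_succ]
    exact ih.mul h

theorem hasFourier_monomial (a b c : ℕ) :
    HasFourier (complexify (seriesE2 ^ a * seriesE4 ^ b * seriesE6 ^ c))
      (E2 ^ a * (E₄ : ℍ → ℂ) ^ b * (E₆ : ℍ → ℂ) ^ c) := by
  simp only [map_mul, map_pow]
  exact ((hasFourier_seriesE2.pow a).mul (hasFourier_seriesE4.pow b)).mul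
    (hasFourier_seriesE6.pow c)

/-- The monomials of weight `k` in the normalised Eisenstein series. -/
def eisensteinMonomials (k : ℕ) : Set ℚ⟦X⟧ :=
  {F | ∃ a b c : ℕ, 2 * a + 4 * b + 6 * c = k ∧ F = seriesE2 ^ a * seriesE4 ^ b * seriesE6 ^ c}

theorem exists_hasFourier_of_mem {k : ℕ} {f : ℍ → ℂ} (hf : f ∈ quasiFunctions k) :
    ∃ F ∈ Submodule.span ℂ (complexify '' eisensteinMonomials k), HasFourier F f := by
  induction hf using Submodule.span_induction with
  | mem x hx =>
    obtain ⟨a, b, c, h, rfl⟩ := hx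
    exact ⟨_, Submodule.subset_span ⟨_, ⟨a, b, c, h, rfl⟩, rfl⟩, hasFourier_monomial a b c⟩
  | zero => exact ⟨0, Submodule.zero_mem _, HasFourier.zero⟩
  | add x y _ _ hx hy =>
    obtain ⟨F, hF, hF'⟩ := hx
    obtain ⟨G, hG, hG'⟩ := hy
    exact ⟨F + G, Submodule.add_mem _ hF hG, hF'.add hG'⟩
  | smul a x _ hx =>
    obtain ⟨F, hF, hF'⟩ := hx
    exact ⟨a • F, Submodule.smul_mem _ _ hF, hF'.smul a⟩

/-- Quasi-modular forms are the polynomials in the Eisenstein series of weights 2, 4 and 6. -/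
theorem quasiModularForms_eq_span (k : ℕ) :
    quasiModularForms k = Submodule.span ℚ (eisensteinMonomials k) := by
  refine le_antisymm ?_ (Submodule.span_le.2 ?_)
  · rintro F ⟨f, hf, hF⟩
    obtain ⟨G, hG, hG'⟩ := exists_hasFourier_of_mem hf.mem_quasiFunctions
    rw [isFourierExpansion_iff] at hF
    refine mem_span_of_complexify_mem ?_
    rwa [hF.unique hG']
  · rintro F ⟨a, b, c, rfl, rfl⟩
    exact ⟨_, isQuasiModularForm_monomial a b c,
      isFourierExpansion_iff.2 (hasFourier_monomial a b c)⟩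

theorem modularForms_le_quasiModularForms (k : ℕ) : modularForms k ≤ quasiModularForms k := by
  rintro F ⟨f, hf⟩
  exact ⟨f, .of_modularForm f, hf⟩

theorem gradedMonoid_quasiModularForms : SetLike.GradedMonoid quasiModularForms where
  one_mem := ⟨1, isQuasiModularForm_one, isFourierExpansion_iff.2 (by simpa using HasFourier.one)⟩
  mul_mem i j F G hF hG := by
    rw [quasiModularForms_eq_span] at hF hG ⊢
    refine mul_mem_of_span ?_ hF hG
    rintro _ ⟨a, b, c, h, rfl⟩ _ ⟨a', b', c', h', rfl⟩
    refine Submodule.subset_span ⟨a + a', b + b', c + c', by omega, ?_⟩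
    ring

theorem gradedMonoid_modularForms : SetLike.GradedMonoid modularForms where
  one_mem := ⟨ModularForm.mcast (by simp) (1 : ModularForm 𝒮ℒ 0),
    isFourierExpansion_iff.2 (by rw [map_one]; exact HasFourier.one)⟩
  mul_mem i j F G hF hG := by
    obtain ⟨f, hf⟩ := hF
    obtain ⟨g, hg⟩ := hG
    rw [isFourierExpansion_iff] at hf hg
    refine ⟨ModularForm.mcast (by push_cast; ring) (f.mul g), isFourierExpansion_iff.2 ?_⟩
    rw [map_mul]
    exact hf.mul hg

theorem isSubalgebra_iSup {W : ℕ → Submodule ℚ ℚ⟦X⟧} (hW : SetLike.GradedMonoid W) :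
    IsSubalgebra (⨆ k, W k) := by
  refine ⟨Submodule.mem_iSup_of_mem 0 hW.one_mem, fun F hF G hG => ?_⟩
  induction hF using Submodule.iSup_induction' with
  | mem i F hF =>
    induction hG using Submodule.iSup_induction' with
    | mem j G hG => exact Submodule.mem_iSup_of_mem (i + j) (hW.mul_mem hF hG)
    | zero =>
      rw [mul_zero]
      exact Submodule.zero_mem _
    | add G H _ _ hG hH =>
      rw [mul_add]
      exact Submodule.add_mem _ hG hH
  | zero =>
    rw [zero_mul]
    exact Submodule.zero_mem _
  | add F H _ _ hF hH =>
    rw [add_mul]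
    exact Submodule.add_mem _ hF hH

/-! ### Independence of the weights -/

/-- For a fixed power of `X` the coefficient is a polynomial in `c` with infinitely many zeros, so
all its coefficients vanish. The one of `c ^ k X ^ (K - k)` is the constant term of `P k`. -/
theorem coeff_eq_zero_of_sum_eq_zero {s : Finset ℕ} {P : ℕ → Polynomial ℂ} {K : ℕ}
    (h : ∀ c : ℕ, 0 < c →
      ∑ k ∈ s, Polynomial.C ((c : ℂ) ^ k) * (Polynomial.X ^ (K - k) * P k) = 0)
    {k : ℕ} (hk : k ∈ s) : (P k).coeff 0 = 0 := by
  set Q : Polynomial ℂ := ∑ i ∈ s, Polynomial.C ((Polynomial.X ^ (K - i) * P i).coeff (K - k)) *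
    Polynomial.X ^ i with hQ
  have hQ0 : Q = 0 := by
    refine Polynomial.eq_zero_of_infinite_isRoot Q ?_
    have hinj : Function.Injective fun c : ℕ => ((c + 1 : ℕ) : ℂ) := fun a b hab => by
      have := Nat.cast_injective hab
      omega
    refine (Set.infinite_range_of_injective hinj).mono ?_
    rintro _ ⟨c, rfl⟩
    have h1 := congrArg (fun p => Polynomial.coeff p (K - k)) (h (c + 1) (Nat.succ_pos c))
    simp only [Polynomial.finsetSum_coeff, Polynomial.coeff_C_mul, Polynomial.coeff_zero] at h1
    simp only [Set.mem_ofPred_eq, Polynomial.IsRoot.def, hQ, Polynomial.eval_finsetSum,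
      Polynomial.eval_mul, Polynomial.eval_C, Polynomial.eval_pow, Polynomial.eval_X]
    rw [← h1]
    exact Finset.sum_congr rfl fun i _ => mul_comm _ _
  have h2 := congrArg (fun p => Polynomial.coeff p k) hQ0
  simp only [hQ, Polynomial.finsetSum_coeff, Polynomial.coeff_C_mul, Polynomial.coeff_X_pow,
    Polynomial.coeff_zero] at h2
  rw [Finset.sum_eq_single k] at h2
  · simpa [Polynomial.coeff_X_pow_mul'] using h2
  · intro i _ hi
    simp [hi.symm]
  · exact fun h' => absurd hk h'

/-- Quasi-modular forms of different weights are linearly independent. -/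
theorem IsQuasiModularForm.eq_zero_of_sum_eq_zero {s : Finset ℕ} {f : ℕ → ℍ → ℂ}
    (hf : ∀ k ∈ s, IsQuasiModularForm k (f k)) (h0 : ∑ k ∈ s, f k = 0) {k : ℕ} (hk : k ∈ s) :
    f k = 0 := by
  choose! p g hg hfg using hf
  ext z
  set P : ℕ → Polynomial ℂ := fun k =>
    ∑ j ∈ Finset.range (p k + 1), Polynomial.C (g k j z) * Polynomial.X ^ j with hP
  have hP0 : ∀ i ∈ s, (P i).coeff 0 = f i z := by
    intro i hi
    have h1 := hfg i hi 1 z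
    rw [SlashAction.slash_one] at h1
    rw [h1]
    simp only [hP, Polynomial.finsetSum_coeff, Polynomial.coeff_C_mul, Polynomial.coeff_X_pow]
    refine Finset.sum_congr rfl fun j _ => ?_
    rcases eq_or_ne j 0 with rfl | hj
    · simp
    · simp [hj, hj.symm]
  rw [← hP0 k hk]
  -- With `x = c / J` one has `f i (γ z) = J ^ i P i (x)`, so `x ^ K f i (γ z) = c ^ i x ^ (K - i) P
  -- i (x)`; taking `K` as the largest weight keeps the exponents nonnegative.
  refine coeff_eq_zero_of_sum_eq_zero (s := s) (K := s.sup id) (fun c hc => ?_) hk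
  have hc' : (c : ℤ) ≠ 0 := by exact_mod_cast hc.ne'
  refine polynomial_eq_of_cocycle c hc' z fun t => ?_
  set γ := lowerUpper c t
  set x := cocycle γ z with hx
  have hJ0 : denom γ z ≠ 0 := denom_ne_zero _ z
  have hxJ : x * denom γ z = c := by
    have : (γ 1 0 : ℂ) = c := by simp [γ, lowerUpper]
    rw [hx, cocycle, div_mul_cancel₀ _ hJ0, this]
  have h1 := congrFun h0 (γ • z)
  rw [Finset.sum_apply, Pi.zero_apply] at h1
  simp only [Polynomial.eval_finsetSum, Polynomial.eval_mul, Polynomial.eval_C,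
    Polynomial.eval_pow, Polynomial.eval_X, Polynomial.eval_zero]
  have h2 : ∀ i ∈ s, (c : ℂ) ^ i * (x ^ (s.sup id - i) * (P i).eval x) =
      x ^ s.sup id * f i (γ • z) := by
    intro i hi
    have hle : i ≤ s.sup id := Finset.le_sup (f := id) hi
    have h3 := hfg i hi γ z
    have h4 : (P i).eval x = f i (γ • z) * (denom γ z ^ i)⁻¹ := by
      rw [ModularForm.SL_slash_apply, zpow_neg, zpow_natCast] at h3
      rw [h3]
      simp only [hP, Polynomial.eval_finsetSum, Polynomial.eval_mul, Polynomial.eval_C,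
        Polynomial.eval_pow, Polynomial.eval_X]
      rfl
    have h5 : x ^ s.sup id = x ^ (s.sup id - i) * x ^ i := by
      rw [← pow_add, Nat.sub_add_cancel hle]
    rw [h4, ← hxJ, mul_pow, h5]
    field_simp
  rw [Finset.sum_congr rfl h2, ← Finset.mul_sum, h1, mul_zero]

theorem iSupIndep_quasiModularForms : iSupIndep quasiModularForms := by
  rw [iSupIndep_iff_finsetSum_eq_zero_imp_eq_zero]
  intro s F hF h0 k hk
  choose! f hf hFf using hF
  have hsum : ∀ t : Finset ℕ, t ⊆ s → IsFourierExpansion (∑ i ∈ t, F i) (∑ i ∈ t, f i) := by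
    intro t
    induction t using Finset.induction_on with
    | empty => exact fun _ => by simpa using isFourierExpansion_zero
    | insert i t hi ih =>
      intro ht
      rw [Finset.sum_insert hi, Finset.sum_insert hi]
      exact (hFf i (ht (Finset.mem_insert_self _ _))).add
        (ih ((Finset.subset_insert _ _).trans ht))
  have h1 := hsum s subset_rfl
  rw [h0, isFourierExpansion_iff, map_zero] at h1
  have h2 := IsQuasiModularForm.eq_zero_of_sum_eq_zero hf (h1.eq_of_eq HasFourier.zero) hk
  have h3 := hFf k hk
  rw [h2, isFourierExpansion_iff] at h3
  refine complexify_injective ?_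
  rw [map_zero]
  exact h3.unique HasFourier.zero

/-! ### Quasi-modular forms inside the brackets, and their derivatives -/

theorem bracketSpan_pow_mem {S : Set ℕ} (hS : ClosedLetters S) {k : ℕ} {F : ℚ⟦X⟧}
    (hF : F ∈ bracketSpan S k) (n : ℕ) : F ^ n ∈ bracketSpan S (k * n) := by
  induction n with
  | zero => simpa using one_mem_bracketSpan S 0
  | succ n ih =>
    rw [pow_succ, mul_add, mul_one]
    exact bracketSpan_mul_mem hS ih hF

theorem eisensteinG_mem_bracketSpan {k : ℕ} (hk : 0 < k) (hk2 : Even k) :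
    eisensteinG k ∈ bracketSpan {s | 0 < s ∧ Even s} k := by
  refine Submodule.add_mem _ ?_ (bracket_mem_bracketSpan (fun i => ?_) (by simp))
  · rw [← mul_one (PowerSeries.C _), ← PowerSeries.smul_eq_C_mul]
    exact Submodule.smul_mem _ _ (one_mem_bracketSpan _ _)
  · simpa using ⟨hk, hk2⟩

/-- The three generators are constants plus even brackets of length one, and the even letters are
closed under products with the weight respected. -/
theorem quasiModularForms_le_bracketSpan (k : ℕ) :
    quasiModularForms k ≤ bracketSpan {s | 0 < s ∧ Even s} k := by
  rw [quasiModularForms_eq_span]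
  refine Submodule.span_le.2 ?_
  rintro _ ⟨a, b, c, rfl, rfl⟩
  have h2 := Submodule.smul_mem _ (-24 : ℚ)
    (eisensteinG_mem_bracketSpan (k := 2) (by norm_num) ⟨1, rfl⟩)
  have h4 := Submodule.smul_mem _ (1440 : ℚ)
    (eisensteinG_mem_bracketSpan (k := 4) (by norm_num) ⟨2, rfl⟩)
  have h6 := Submodule.smul_mem _ (-60480 : ℚ)
    (eisensteinG_mem_bracketSpan (k := 6) (by norm_num) ⟨3, rfl⟩)
  exact bracketSpan_mul_mem closedLetters_even (bracketSpan_mul_mem closedLetters_even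
    (bracketSpan_pow_mem closedLetters_even h2 a) (bracketSpan_pow_mem closedLetters_even h4 b))
    (bracketSpan_pow_mem closedLetters_even h6 c)

theorem quasiModularForms_le_weightFil (k : ℕ) : quasiModularForms k ≤ weightFil k :=
  (quasiModularForms_le_bracketSpan k).trans (bracketSpan_mono (fun _ hs => hs.1) le_rfl)

theorem quasiModularFormRing_le_MDEven : quasiModularFormRing ≤ MDEven :=
  iSup_le fun k => (quasiModularForms_le_bracketSpan k).trans (bracketSpan_even_le_MDEven k)

theorem eisensteinG_mem_quasiModularForms :
    eisensteinG 2 ∈ quasiModularForms 2 ∧ eisensteinG 4 ∈ quasiModularForms 4 ∧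
      eisensteinG 6 ∈ quasiModularForms 6 := by
  simp only [quasiModularForms_eq_span]
  refine ⟨?_, ?_, ?_⟩
  · have h : eisensteinG 2 = (-1 / 24 : ℚ) • (seriesE2 ^ 1 * seriesE4 ^ 0 * seriesE6 ^ 0) := by
      simp [seriesE2, smul_smul]
    rw [h]
    exact Submodule.smul_mem _ _ (Submodule.subset_span ⟨1, 0, 0, rfl, rfl⟩)
  · have h : eisensteinG 4 = (1 / 1440 : ℚ) • (seriesE2 ^ 0 * seriesE4 ^ 1 * seriesE6 ^ 0) := by
      simp [seriesE4, smul_smul]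
    rw [h]
    exact Submodule.smul_mem _ _ (Submodule.subset_span ⟨0, 1, 0, rfl, rfl⟩)
  · have h : eisensteinG 6 = (-1 / 60480 : ℚ) • (seriesE2 ^ 0 * seriesE4 ^ 0 * seriesE6 ^ 1) := by
      simp [seriesE6, smul_smul]
    rw [h]
    exact Submodule.smul_mem _ _ (Submodule.subset_span ⟨0, 0, 1, rfl, rfl⟩)

/-- The quasi-modular forms of weight `k` whose derivative is quasi-modular of weight `k + 2`. -/
def DQuasi (k : ℕ) (F : ℚ⟦X⟧) : Prop := F ∈ quasiModularForms k ∧ d F ∈ quasiModularForms (k + 2)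

theorem DQuasi.mul {k l : ℕ} {F G : ℚ⟦X⟧} (hF : DQuasi k F) (hG : DQuasi l G) :
    DQuasi (k + l) (F * G) := by
  have hW := gradedMonoid_quasiModularForms
  refine ⟨hW.mul_mem hF.1 hG.1, ?_⟩
  rw [Derivation.leibniz, smul_eq_mul, smul_eq_mul]
  have h1 := hW.mul_mem hF.1 hG.2
  have h2 := hW.mul_mem hG.1 hF.2
  rw [← add_assoc] at h1 h2
  rw [add_comm l k] at h2
  exact Submodule.add_mem _ h1 h2

theorem DQuasi.smul {k : ℕ} {F : ℚ⟦X⟧} (c : ℚ) (hF : DQuasi k F) : DQuasi k (c • F) :=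
  ⟨Submodule.smul_mem _ _ hF.1, by rw [d_smul]; exact Submodule.smul_mem _ _ hF.2⟩

theorem DQuasi.pow {k : ℕ} {F : ℚ⟦X⟧} (hF : DQuasi k F) (n : ℕ) : DQuasi (k * n) (F ^ n) := by
  induction n with
  | zero =>
    refine ⟨?_, ?_⟩
    · rw [pow_zero, mul_zero]
      exact gradedMonoid_quasiModularForms.one_mem
    · rw [pow_zero, Derivation.map_one_eq_zero]
      exact Submodule.zero_mem _
  | succ n ih =>
    rw [pow_succ, mul_add, mul_one]
    exact ih.mul hF

theorem natCast_mul_mem (n : ℕ) {V : Submodule ℚ ℚ⟦X⟧} {F : ℚ⟦X⟧} (hF : F ∈ V) :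
    (n : ℚ⟦X⟧) * F ∈ V := by
  rw [← nsmul_eq_mul]
  exact Submodule.smul_of_tower_mem V n hF

/-- The right-hand sides of Ramanujan's identities are homogeneous of weight `k + 2`. The Leibniz
rule extends this from the generators to all monomials. -/
theorem dQuasi_eisensteinG : DQuasi 2 (eisensteinG 2) ∧ DQuasi 4 (eisensteinG 4) ∧
    DQuasi 6 (eisensteinG 6) := by
  obtain ⟨h2, h4, h6⟩ := eisensteinG_mem_quasiModularForms
  have hW := gradedMonoid_quasiModularForms
  have h22 : eisensteinG 2 * eisensteinG 2 ∈ quasiModularForms (2 + 2) := hW.mul_mem h2 h2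
  have h24 : eisensteinG 2 * eisensteinG 4 ∈ quasiModularForms (2 + 4) := hW.mul_mem h2 h4
  have h26 : eisensteinG 2 * eisensteinG 6 ∈ quasiModularForms (2 + 6) := hW.mul_mem h2 h6
  have h44 : eisensteinG 4 * eisensteinG 4 ∈ quasiModularForms (4 + 4) := hW.mul_mem h4 h4
  refine ⟨⟨h2, ?_⟩, ⟨h4, ?_⟩, ⟨h6, ?_⟩⟩
  · rw [ramanujan_two, sq]
    exact Submodule.sub_mem _ (natCast_mul_mem 5 h4) (natCast_mul_mem 2 h22)
  · rw [ramanujan_four, mul_assoc]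
    exact Submodule.sub_mem _ (natCast_mul_mem 14 h6) (natCast_mul_mem 8 h24)
  · rw [ramanujan_six, mul_assoc, sq]
    exact Submodule.sub_mem _ (Submodule.smul_mem _ _ h44)
      (natCast_mul_mem 12 h26)

theorem d_mem_quasiModularForms {k : ℕ} {F : ℚ⟦X⟧} (hF : F ∈ quasiModularForms k) :
    d F ∈ quasiModularForms (k + 2) := by
  suffices quasiModularForms k ≤ (quasiModularForms (k + 2)).comap d.toLinearMap from this hF
  nth_rw 1 [quasiModularForms_eq_span]
  refine Submodule.span_le.2 ?_
  rintro _ ⟨a, b, c, rfl, rfl⟩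
  obtain ⟨h2, h4, h6⟩ := dQuasi_eisensteinG
  exact ((((h2.smul (-24)).pow a).mul ((h4.smul 1440).pow b)).mul ((h6.smul (-60480)).pow c)).2

theorem d_mem_quasiModularFormRing {F : ℚ⟦X⟧} (hF : F ∈ quasiModularFormRing) :
    d F ∈ quasiModularFormRing := by
  suffices quasiModularFormRing ≤ quasiModularFormRing.comap d.toLinearMap from this hF
  exact iSup_le fun k F hF => Submodule.mem_iSup_of_mem (k + 2) (d_mem_quasiModularForms hF)

end BracketAlgebra

open BracketAlgebra in
theorem mainTheorem9 :
    -- the ambient filtered differential algebra `(MD, d)`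
    (IsSubalgebra MD ∧ (∀ k l, weightFil k * weightFil l ≤ weightFil (k + l)) ∧
      (∀ F ∈ MD, d F ∈ MD) ∧ (∀ k, ∀ F ∈ weightFil k, d F ∈ weightFil (k + 2))) ∧
    -- modular and quasi-modular forms are graded subalgebras of `MD`
    (IsGradedSubalgebra modularFormRing modularForms ∧ modularFormRing ≤ MD ∧
      ∀ k, modularForms k ≤ weightFil k) ∧
    (IsGradedSubalgebra quasiModularFormRing quasiModularForms ∧ quasiModularFormRing ≤ MD ∧
      ∀ k, quasiModularForms k ≤ weightFil k) ∧
    -- quasi-modular forms are closed under `d`, and the identities of Ramanujan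
    ((∀ F ∈ quasiModularFormRing, d F ∈ quasiModularFormRing) ∧
      (∀ k, ∀ F ∈ quasiModularForms k, d F ∈ quasiModularForms (k + 2))) ∧
    (d (eisensteinG 2) = 5 * eisensteinG 4 - 2 * eisensteinG 2 ^ 2 ∧
      d (eisensteinG 4) = 14 * eisensteinG 6 - 8 * eisensteinG 2 * eisensteinG 4 ∧
      d (eisensteinG 6) =
        (120 / 7 : ℚ) • eisensteinG 4 ^ 2 - 12 * eisensteinG 2 * eisensteinG 6) ∧
    -- the chain of inclusions of algebras
    (IsSubalgebra MDEven ∧ IsSubalgebra MDSharp ∧ IsSubalgebra MDA ∧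
      (∀ k, modularForms k ≤ quasiModularForms k) ∧ modularFormRing ≤ quasiModularFormRing ∧
      quasiModularFormRing ≤ MDEven ∧ MDEven ≤ MDSharp ∧ MDSharp ≤ MDA ∧ MDA ≤ MD) := by
  have hle : modularFormRing ≤ quasiModularFormRing := iSup_mono modularForms_le_quasiModularForms
  have hMD : quasiModularFormRing ≤ MD :=
    iSup_le fun k => (quasiModularForms_le_weightFil k).trans (weightFil_le_MD k)
  exact ⟨⟨isSubalgebra_MD,
      fun k l => Submodule.mul_le.2 fun F hF G hG => bracketSpan_mul_mem closedLetters_pos hF hG,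
      fun F hF => d_mem_MD hF, fun k F hF => d_mem_weightFil hF⟩,
    ⟨⟨isSubalgebra_iSup gradedMonoid_modularForms, rfl,
      iSupIndep_quasiModularForms.mono modularForms_le_quasiModularForms,
      gradedMonoid_modularForms⟩, hle.trans hMD, fun k =>
      (modularForms_le_quasiModularForms k).trans (quasiModularForms_le_weightFil k)⟩,
    ⟨⟨isSubalgebra_iSup gradedMonoid_quasiModularForms, rfl, iSupIndep_quasiModularForms,
      gradedMonoid_quasiModularForms⟩, hMD, quasiModularForms_le_weightFil⟩,
    ⟨fun F hF => d_mem_quasiModularFormRing hF, fun k F hF => d_mem_quasiModularForms hF⟩,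
    ⟨ramanujan_two, ramanujan_four, ramanujan_six⟩,
    ⟨isSubalgebra_MDEven, isSubalgebra_MDSharp, isSubalgebra_MDA,
      modularForms_le_quasiModularForms, hle, quasiModularFormRing_le_MDEven, MDEven_le_MDSharp,
      MDSharp_le_MDA, MDA_le_MD⟩⟩
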